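/- Let $(\Omega,\Sigma,\mathbb{P})$ be a nonatomic probability space, and let $\Phi:[0,\infty)\to[0,\infty)$ be an Orlicz function, that is, a convex increasing function with $\Phi(0)=0$. Assume that $\Phi(t)>0$ for all $t>0$ and $\lim_{t\to\infty}\Phi(t)/t=\infty$, and let $\Psi(s)=\sup\{ts-\Phi(t):t\ge 0\}$, $s\ge 0$, be the conjugate function, which is then also an Orlicz function. For an Orlicz function $\Theta$ let $L^\Theta$ be the space of real random variables $X$ on $\Omega$, modulo almost sure equality, with finite Luxemburg norm $\|X\|_\Theta=\inf\{\lambda>0:\mathbb{E}[\Theta(|X|/\lambda)]\le 1\}$ ($\inf\emptyset=\infty$). Let $\mathcal{B}=\{X\in L^\Phi:\|X\|_\Phi\le 1\}$, and let $\sigma(L^\Phi,L^\Psi)$ be the weak topology on $L^\Phi$ induced by the functionals $X\mapsto\mathbb{E}[XY]$, $Y\in L^\Psi$. A sequence $(X_n)$ in $L^\Phi$ order converges to $X\in L^\Phi$ if $X_n\to X$ almost surely and there is $Z\in L^\Phi$ with $|X_n|\le Z$ almost surely for all $n$. A set $\mathcal{C}\subset L^\Phi$ is order closed if it equals the set of all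 limits in $L^\Phi$ of order convergent sequences of elements of $\mathcal{C}$. Then, for every convex set $\mathcal{C}\subset L^\Phi$, the following statements are equivalent: (1) $\mathcal{C}$ is order closed; (2) $\mathcal{C}$ is $\sigma(L^\Phi,L^\Psi)$-sequentially closed; (3) $\mathcal{C}\cap k\mathcal{B}$ is $\sigma(L^\Phi,L^\Psi)$-closed for all integers $k\ge 1$. -/

import Mathlib

open MeasureTheory Filter Topology Set
open scoped Pointwise ENNReal

namespace Orlicz

/-- A finite Orlicz function `[0,∞) → [0,∞)`: convex, increasing and vanishing at `0`
(nonnegativity on `[0,∞)` follows). It is given as a function on `ℝ`; only its values on `[0,∞)`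
are ever used. -/
structure IsOrliczFunction (Φ : ℝ → ℝ) : Prop where
  convexOn : ConvexOn ℝ (Ici 0) Φ
  monotoneOn : MonotoneOn Φ (Ici 0)
  map_zero : Φ 0 = 0

/-- The conjugate function `s ↦ sup {t s - Φ t : t ≥ 0}`. -/
noncomputable def conjugate (Φ : ℝ → ℝ) (s : ℝ) : ℝ :=
  sSup ((fun t => t * s - Φ t) '' Ici 0)

variable {Φ : ℝ → ℝ}

theorem IsOrliczFunction.nonneg (h : IsOrliczFunction Φ) {t : ℝ} (ht : 0 ≤ t) : 0 ≤ Φ t := by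
  have := h.monotoneOn (mem_Ici.2 le_rfl) (mem_Ici.2 ht) ht
  rwa [h.map_zero] at this

/-- If `Φ t / t → ∞`, the supremum defining the conjugate function is finite. -/
theorem bddAbove_conjugate (h : IsOrliczFunction Φ)
    (hsup : Tendsto (fun t => Φ t / t) atTop atTop) {s : ℝ} (hs : 0 ≤ s) :
    BddAbove ((fun t => t * s - Φ t) '' Ici 0) := by
  obtain ⟨T, hT⟩ := ((tendsto_atTop.1 hsup s).and (eventually_ge_atTop 1)).exists_forall_of_atTop
  refine ⟨T * s, ?_⟩
  rintro _ ⟨t, ht, rfl⟩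
  have ht' : (0 : ℝ) ≤ t := ht
  have hT1 : 1 ≤ T := (hT T le_rfl).2
  show t * s - Φ t ≤ T * s
  rcases le_total T t with hle | hle
  · have h1 := (hT t hle).1
    rw [le_div_iff₀ (by linarith)] at h1
    nlinarith [mul_nonneg (by linarith : 0 ≤ T) hs]
  · nlinarith [h.nonneg ht', mul_le_mul_of_nonneg_right hle hs]

/-- Young's inequality. -/
theorem young (h : IsOrliczFunction Φ) (hsup : Tendsto (fun t => Φ t / t) atTop atTop)
    {t s : ℝ} (ht : 0 ≤ t) (hs : 0 ≤ s) : t * s ≤ Φ t + conjugate Φ s := by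
  have := le_csSup (bddAbove_conjugate h hsup hs) ⟨t, ht, rfl⟩
  have h2 : t * s - Φ t ≤ conjugate Φ s := this
  linarith

/-- The conjugate of an Orlicz function with `Φ t / t → ∞` is again an Orlicz function. -/
theorem IsOrliczFunction.conjugate (h : IsOrliczFunction Φ)
    (hsup : Tendsto (fun t => Φ t / t) atTop atTop) : IsOrliczFunction (conjugate Φ) where
  convexOn := by
    refine ⟨convex_Ici 0, ?_⟩
    intro x hx y hy a b ha hb hab
    refine csSup_le (nonempty_Ici.image _) ?_
    rintro _ ⟨t, ht, rfl⟩
    have h1 := mul_le_mul_of_nonneg_left (young h hsup (mem_Ici.1 ht) (mem_Ici.1 hx)) ha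
    have h2 := mul_le_mul_of_nonneg_left (young h hsup (mem_Ici.1 ht) (mem_Ici.1 hy)) hb
    have h3 : Φ t = a * Φ t + b * Φ t := by rw [← add_mul, hab, one_mul]
    simp only [smul_eq_mul]
    nlinarith
  monotoneOn := by
    intro x hx y hy hxy
    refine csSup_le (nonempty_Ici.image _) ?_
    rintro _ ⟨t, ht, rfl⟩
    have h1 := young h hsup (mem_Ici.1 ht) (mem_Ici.1 hy)
    have h2 := mul_le_mul_of_nonneg_left hxy (mem_Ici.1 ht)
    show t * x - Φ t ≤ _
    linarith
  map_zero := by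
    apply le_antisymm
    · refine csSup_le (nonempty_Ici.image _) ?_
      rintro _ ⟨t, ht, rfl⟩
      have := h.nonneg (mem_Ici.1 ht)
      simpa using this
    · have := young h hsup (le_refl (0 : ℝ)) (le_refl (0 : ℝ))
      simpa [h.map_zero] using this

variable {Ω : Type*} [MeasurableSpace Ω] {P : Measure Ω}

/-- A measure is nonatomic if every measurable set of positive measure has a measurable subset of
strictly smaller positive measure. (Mathlib's null-singleton class is a weaker notion.) -/
def IsNonatomic (P : Measure Ω) : Prop :=
  ∀ A, MeasurableSet A → 0 < P A → ∃ B ⊆ A, MeasurableSet B ∧ 0 < P B ∧ P B < P A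

/-- The modular `E[Φ(|X| / c)]`, with values in `[0,∞]`. -/
noncomputable def modular (Φ : ℝ → ℝ) (c : ℝ) (X : Ω →ₘ[P] ℝ) : ℝ≥0∞ :=
  ∫⁻ ω, ENNReal.ofReal (Φ (|X ω| / c)) ∂P

/-- The Luxemburg norm `inf {c > 0 : E[Φ(|X| / c)] ≤ 1}`, with values in `[0,∞]`;
it is `∞` if there is no such `c`. -/
noncomputable def luxemburgNorm (Φ : ℝ → ℝ) (X : Ω →ₘ[P] ℝ) : ℝ≥0∞ :=
  ⨅ (c : ℝ) (_ : 0 < c ∧ modular Φ c X ≤ 1), ENNReal.ofReal c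

theorem luxemburgNorm_lt_top_iff (X : Ω →ₘ[P] ℝ) :
    luxemburgNorm Φ X < ⊤ ↔ ∃ c : ℝ, 0 < c ∧ modular Φ c X ≤ 1 := by
  simp [luxemburgNorm, iInf_lt_iff]

theorem IsOrliczFunction.aemeasurable (h : IsOrliczFunction Φ) {c : ℝ} (hc : 0 < c)
    (X : Ω →ₘ[P] ℝ) : AEMeasurable (fun ω => ENNReal.ofReal (Φ (|X ω| / c))) P := by
  have hm : Monotone (fun t : ℝ => Φ (max t 0)) := fun a b hab =>
    h.monotoneOn (mem_Ici.2 (le_max_right _ _)) (mem_Ici.2 (le_max_right _ _))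
      (max_le_max hab le_rfl)
  have hX : AEMeasurable (fun ω => |X ω| / c) P :=
    (continuous_abs.measurable.comp_aemeasurable X.aemeasurable).div_const c
  have := (hm.measurable.comp_aemeasurable hX).ennreal_ofReal
  refine this.congr (Eventually.of_forall fun ω => ?_)
  have : 0 ≤ |X ω| / c := by positivity
  simp [max_eq_left this]

/-- The Orlicz space `L^Φ(P)`: the real random variables, modulo almost sure equality, of finite
Luxemburg norm. -/
noncomputable def orliczSpace (h : IsOrliczFunction Φ) (P : Measure Ω) :
    Submodule ℝ (Ω →ₘ[P] ℝ) where
  carrier := {X | luxemburgNorm Φ X < ⊤}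
  zero_mem' := by
    refine (luxemburgNorm_lt_top_iff _).2 ⟨1, one_pos, ?_⟩
    have : modular Φ 1 (0 : Ω →ₘ[P] ℝ) = 0 := by
      rw [modular, ← lintegral_zero (μ := P)]
      refine lintegral_congr_ae ?_
      filter_upwards [AEEqFun.coeFn_zero (μ := P) (β := ℝ) (α := Ω)] with ω hω
      simp [hω, h.map_zero]
    simp [this]
  add_mem' := by
    intro X Y hX hY
    obtain ⟨c, hc, hcX⟩ := (luxemburgNorm_lt_top_iff _).1 hX
    obtain ⟨d, hd, hdY⟩ := (luxemburgNorm_lt_top_iff _).1 hY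
    refine (luxemburgNorm_lt_top_iff _).2 ⟨c + d, add_pos hc hd, ?_⟩
    have hcd : 0 < c + d := add_pos hc hd
    have ha : 0 ≤ c / (c + d) := by positivity
    have hb : 0 ≤ d / (c + d) := by positivity
    have hab : c / (c + d) + d / (c + d) = 1 := by field_simp
    calc modular Φ (c + d) (X + Y)
        ≤ ∫⁻ ω, (ENNReal.ofReal (c / (c + d)) * ENNReal.ofReal (Φ (|X ω| / c)) +
            ENNReal.ofReal (d / (c + d)) * ENNReal.ofReal (Φ (|Y ω| / d))) ∂P := by
          refine lintegral_mono_ae ?_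
          filter_upwards [AEEqFun.coeFn_add X Y] with ω hω
          rw [hω, ← ENNReal.ofReal_mul ha, ← ENNReal.ofReal_mul hb, ← ENNReal.ofReal_add
            (mul_nonneg ha (h.nonneg (by positivity))) (mul_nonneg hb (h.nonneg (by positivity)))]
          refine ENNReal.ofReal_le_ofReal ?_
          have hx : (0 : ℝ) ≤ |X ω| / c := by positivity
          have hy : (0 : ℝ) ≤ |Y ω| / d := by positivity
          refine le_trans ?_ (h.convexOn.2 hx hy ha hb hab)
          refine h.monotoneOn (mem_Ici.2 (by positivity)) (mem_Ici.2 (by positivity)) ?_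
          have : c / (c + d) * (|X ω| / c) + d / (c + d) * (|Y ω| / d)
              = (|X ω| + |Y ω|) / (c + d) := by field_simp
          simp only [smul_eq_mul, this, Pi.add_apply]
          exact div_le_div_of_nonneg_right (abs_add_le _ _) hcd.le
      _ = ENNReal.ofReal (c / (c + d)) * modular Φ c X +
            ENNReal.ofReal (d / (c + d)) * modular Φ d Y := by
          rw [lintegral_add_left' ((h.aemeasurable hc X).const_mul _),
            lintegral_const_mul' _ _ ENNReal.ofReal_ne_top,
            lintegral_const_mul' _ _ ENNReal.ofReal_ne_top, modular, modular]
      _ ≤ ENNReal.ofReal (c / (c + d)) * 1 + ENNReal.ofReal (d / (c + d)) * 1 := by gcongr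
      _ = 1 := by rw [mul_one, mul_one, ← ENNReal.ofReal_add ha hb, hab, ENNReal.ofReal_one]
  smul_mem' := by
    intro a X hX
    obtain ⟨c, hc, hcX⟩ := (luxemburgNorm_lt_top_iff _).1 hX
    refine (luxemburgNorm_lt_top_iff _).2 ⟨(|a| + 1) * c, by positivity, le_trans ?_ hcX⟩
    refine lintegral_mono_ae ?_
    filter_upwards [AEEqFun.coeFn_smul a X] with ω hω
    rw [hω]
    refine ENNReal.ofReal_le_ofReal
      (h.monotoneOn (mem_Ici.2 (by positivity)) (mem_Ici.2 (by positivity)) ?_)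
    rw [Pi.smul_apply, smul_eq_mul, abs_mul, div_le_div_iff₀ (by positivity) hc]
    nlinarith [abs_nonneg a, mul_nonneg (abs_nonneg (X ω)) hc.le]

theorem mem_orliczSpace (h : IsOrliczFunction Φ) (X : Ω →ₘ[P] ℝ) :
    X ∈ orliczSpace h P ↔ luxemburgNorm Φ X < ⊤ := Iff.rfl

/-- For `X ∈ L^Φ` and `Y ∈ L^Ψ`, with `Ψ` the conjugate of `Φ`, the product `X Y` is integrable. -/
theorem integrable_mul (h : IsOrliczFunction Φ) (hsup : Tendsto (fun t => Φ t / t) atTop atTop)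
    (X : orliczSpace h P) (Y : orliczSpace (h.conjugate hsup) P) :
    Integrable (fun ω => X.1 ω * Y.1 ω) P := by
  obtain ⟨c, hc, hcX⟩ := (luxemburgNorm_lt_top_iff _).1 X.2
  obtain ⟨d, hd, hdY⟩ := (luxemburgNorm_lt_top_iff _).1 Y.2
  refine ⟨X.1.aestronglyMeasurable.mul Y.1.aestronglyMeasurable, ?_⟩
  have hle : ∀ ω, ‖X.1 ω * Y.1 ω‖ₑ ≤ ENNReal.ofReal (c * d) *
      (ENNReal.ofReal (Φ (|X.1 ω| / c)) + ENNReal.ofReal (conjugate Φ (|Y.1 ω| / d))) := by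
    intro ω
    have hx : (0 : ℝ) ≤ |X.1 ω| / c := by positivity
    have hy : (0 : ℝ) ≤ |Y.1 ω| / d := by positivity
    rw [← ENNReal.ofReal_add (h.nonneg hx) ((h.conjugate hsup).nonneg hy),
      ← ENNReal.ofReal_mul (by positivity), ← ofReal_norm]
    refine ENNReal.ofReal_le_ofReal ?_
    have h1 := mul_le_mul_of_nonneg_left (young h hsup hx hy) (by positivity : 0 ≤ c * d)
    have h2 : c * d * (|X.1 ω| / c * (|Y.1 ω| / d)) = |X.1 ω| * |Y.1 ω| := by field_simp
    rw [Real.norm_eq_abs, abs_mul]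
    linarith
  refine lt_of_le_of_lt (lintegral_mono hle) ?_
  rw [lintegral_const_mul' _ _ ENNReal.ofReal_ne_top, lintegral_add_left' (h.aemeasurable hc X.1)]
  exact ENNReal.mul_lt_top ENNReal.ofReal_lt_top (ENNReal.add_lt_top.2
    ⟨hcX.trans_lt ENNReal.one_lt_top, hdY.trans_lt ENNReal.one_lt_top⟩)

/-- The duality pairing `⟨X, Y⟩ = E[X Y]` of `L^Φ` and `L^Ψ`, with `Ψ` the conjugate of `Φ`. -/
noncomputable def pairing (h : IsOrliczFunction Φ)
    (hsup : Tendsto (fun t => Φ t / t) atTop atTop) (P : Measure Ω) :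
    orliczSpace h P →ₗ[ℝ] orliczSpace (h.conjugate hsup) P →ₗ[ℝ] ℝ :=
  LinearMap.mk₂ ℝ (fun X Y => ∫ ω, X.1 ω * Y.1 ω ∂P)
    (fun X X' Y => by
      rw [← integral_add (integrable_mul h hsup X Y) (integrable_mul h hsup X' Y)]
      refine integral_congr_ae ?_
      filter_upwards [AEEqFun.coeFn_add X.1 X'.1] with ω hω
      simp [hω, add_mul])
    (fun a X Y => by
      rw [smul_eq_mul, ← integral_const_mul]
      refine integral_congr_ae ?_
      filter_upwards [AEEqFun.coeFn_smul a X.1] with ω hω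
      simp [hω, mul_assoc])
    (fun X Y Y' => by
      rw [← integral_add (integrable_mul h hsup X Y) (integrable_mul h hsup X Y')]
      refine integral_congr_ae ?_
      filter_upwards [AEEqFun.coeFn_add Y.1 Y'.1] with ω hω
      simp [hω, mul_add])
    (fun a X Y => by
      rw [smul_eq_mul, ← integral_const_mul]
      refine integral_congr_ae ?_
      filter_upwards [AEEqFun.coeFn_smul a Y.1] with ω hω
      simp [hω, mul_left_comm])

/-- The weak topology `σ(L^Φ, L^Ψ)` on `L^Φ`, with `Ψ` the conjugate of `Φ`: the coarsest topology
for which all functionals `X ↦ E[X Y]` with `Y ∈ L^Ψ` are continuous. -/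
@[reducible]
noncomputable def weakTopology (h : IsOrliczFunction Φ)
    (hsup : Tendsto (fun t => Φ t / t) atTop atTop) (P : Measure Ω) :
    TopologicalSpace (orliczSpace h P) :=
  inferInstanceAs (TopologicalSpace (WeakBilin (pairing h hsup P)))

/-- Order convergence of a sequence in `L^Φ`: almost sure convergence together with order
boundedness in `L^Φ`. -/
def OrderConverges {h : IsOrliczFunction Φ} (X : ℕ → orliczSpace h P) (X₀ : orliczSpace h P) :
    Prop :=
  (∀ᵐ ω ∂P, Tendsto (fun n => (X n).1 ω) atTop (𝓝 (X₀.1 ω))) ∧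
    ∃ Z : orliczSpace h P, ∀ n, ∀ᵐ ω ∂P, |(X n).1 ω| ≤ Z.1 ω

/-- The order closure of a subset of `L^Φ`: all order limits of sequences in the set. -/
def orderClosure {h : IsOrliczFunction Φ} (C : Set (orliczSpace h P)) : Set (orliczSpace h P) :=
  {X₀ | ∃ X : ℕ → orliczSpace h P, (∀ n, X n ∈ C) ∧ OrderConverges X X₀}

/-- A subset of `L^Φ` is order closed if it equals its order closure. -/
def IsOrderClosed {h : IsOrliczFunction Φ} (C : Set (orliczSpace h P)) : Prop :=
  C = orderClosure C

/-- The closed unit ball of `L^Φ` for the Luxemburg norm. -/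
def unitBall (h : IsOrliczFunction Φ) (P : Measure Ω) : Set (orliczSpace h P) :=
  {X | luxemburgNorm Φ X.1 ≤ 1}

end Orlicz

namespace Orlicz

/-! ### Convexity, subgradients and biconjugation of Orlicz functions -/

section Functions

variable {Φ : ℝ → ℝ}

/-! The cycle is (1) ⇒ (3) ⇒ (2) ⇒ (1), and (1) ⇒ (3) carries the weight.

(1) ⇒ (3). Let `X₀` be in the weak closure of `C ∩ kB`. After translating by `X₀` and rescaling,
this set becomes a convex set `D` of elements of finite modular with `0` in its weak closure. By
`exists_modular_two_le`, `D` has elements of arbitrarily small modular. Otherwise, among simple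
functions, a small modular ball would be disjoint from the modular neighbourhood of `D`, and
Hahn–Banach would give a functional separating them. A functional bounded on a modular ball is
integration against some `Y` (`exists_density`, by Radon–Nikodym) with `Y ∈ L^Ψ`
(`lintegral_conjugate_le_one`), so `Y` would separate `D` weakly from `0`. Simple functions need not
be norm dense in `L^Φ`, but they approximate every element of finite modular in the modular.
Elements with summable modulars then give a sequence in `C ∩ kB` that order converges to `X₀`
(`orderConverges_of_tsum_modular_lt_top`). Order closedness puts `X₀` in `C`, and Fatou's lemma puts
it in `kB`.

(3) ⇒ (2). A weakly convergent sequence is weakly bounded, hence lies in some `kB`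
(`exists_modular_le_one_of_weakly_bounded`). This is uniform boundedness on `ℓ¹`, applied to series
of elements of the modular ball of `L^Ψ`.

(2) ⇒ (1). By dominated convergence, order convergence implies weak convergence. -/

theorem IsOrliczFunction.map_mul_le (h : IsOrliczFunction Φ) {a t : ℝ} (ha : 0 ≤ a) (ha1 : a ≤ 1)
    (ht : 0 ≤ t) : Φ (a * t) ≤ a * Φ t := by
  have := h.convexOn.2 (mem_Ici.2 ht) (mem_Ici.2 le_rfl) ha (sub_nonneg.2 ha1) (by ring)
  simpa [h.map_zero] using this

theorem IsOrliczFunction.tendsto_zero (h : IsOrliczFunction Φ) {u : ℕ → ℝ} (hu : ∀ n, 0 ≤ u n)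
    (hlim : Tendsto u atTop (𝓝 0)) : Tendsto (fun n => Φ (u n)) atTop (𝓝 0) := by
  have h1 : ∀ᶠ n in atTop, Φ (u n) ≤ u n * Φ 1 := by
    filter_upwards [hlim.eventually (ge_mem_nhds zero_lt_one)] with n hn
    simpa using h.map_mul_le (hu n) hn zero_le_one
  refine tendsto_of_tendsto_of_tendsto_of_le_of_le' tendsto_const_nhds
    (by simpa using hlim.mul_const (Φ 1)) (Eventually.of_forall fun n => h.nonneg (hu n)) h1

/-- Strict positivity of `Φ` off `0` enters here: it turns small modulars into small values, which
makes modular convergence pointwise. -/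
theorem IsOrliczFunction.tendsto_zero_of_tendsto (h : IsOrliczFunction Φ)
    (hpos : ∀ t : ℝ, 0 < t → 0 < Φ t) {u : ℕ → ℝ} (hu : ∀ n, 0 ≤ u n)
    (hlim : Tendsto (fun n => Φ (u n)) atTop (𝓝 0)) : Tendsto u atTop (𝓝 0) := by
  refine tendsto_order.2 ⟨fun a ha => Eventually.of_forall fun n => ha.trans_le (hu n),
    fun a ha => ?_⟩
  filter_upwards [hlim.eventually (gt_mem_nhds (hpos a ha))] with n hn
  by_contra! hcon
  exact absurd (h.monotoneOn (mem_Ici.2 ha.le) (mem_Ici.2 (hu n)) hcon) (not_le.2 hn)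

/-- Chord slopes of a convex function increase, so the supremum of the slopes to the left of `t`
lies below every slope to the right. At `t = 0` the slope `0` works. -/
theorem IsOrliczFunction.exists_subgradient (h : IsOrliczFunction Φ) {t : ℝ} (ht : 0 ≤ t) :
    ∃ s, 0 ≤ s ∧ ∀ u, 0 ≤ u → Φ t + s * (u - t) ≤ Φ u := by
  rcases ht.eq_or_lt with rfl | ht
  · exact ⟨0, le_rfl, fun u hu => by simpa [h.map_zero] using h.nonneg hu⟩
  have hslope : ∀ u, 0 ≤ u → u < t → ∀ v, t < v →
      (Φ t - Φ u) / (t - u) ≤ (Φ v - Φ t) / (v - t) := fun u hu hut v htv =>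
    h.convexOn.slope_mono_adjacent (mem_Ici.2 hu) (mem_Ici.2 (by linarith)) hut htv
  set S : Set ℝ := (fun u => (Φ t - Φ u) / (t - u)) '' Ico 0 t
  have hbdd : BddAbove S := by
    refine ⟨(Φ (t + 1) - Φ t) / (t + 1 - t), ?_⟩
    rintro _ ⟨u, hu, rfl⟩
    exact hslope u hu.1 hu.2 _ (by linarith)
  have hle : ∀ u, 0 ≤ u → u < t → (Φ t - Φ u) / (t - u) ≤ sSup S := fun u hu hut =>
    le_csSup hbdd ⟨u, ⟨hu, hut⟩, rfl⟩
  have hge : ∀ v, t < v → sSup S ≤ (Φ v - Φ t) / (v - t) := fun v hv => by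
    refine csSup_le ⟨_, 0, ⟨le_rfl, ht⟩, rfl⟩ ?_
    rintro _ ⟨u, hu, rfl⟩
    exact hslope u hu.1 hu.2 v hv
  refine ⟨sSup S, ?_, fun u hu => ?_⟩
  · refine le_trans ?_ (hle 0 le_rfl ht)
    rw [h.map_zero]
    have := h.nonneg ht.le
    simp only [sub_zero]
    positivity
  · rcases lt_trichotomy u t with hut | rfl | hut
    · have := hle u hu hut
      rw [div_le_iff₀ (by linarith)] at this
      linarith
    · simp
    · have := hge u hut
      rw [le_div_iff₀ (by linarith)] at this
      linarith

/-- The conjugate of the conjugate is well defined and dominates the original function. -/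
theorem bddAbove_conjugate_conjugate (h : IsOrliczFunction Φ)
    (hsup : Tendsto (fun t => Φ t / t) atTop atTop) {t : ℝ} (ht : 0 ≤ t) :
    BddAbove ((fun s => s * t - conjugate Φ s) '' Ici 0) := by
  refine ⟨Φ t, ?_⟩
  rintro _ ⟨s, hs, rfl⟩
  have := young h hsup ht (mem_Ici.1 hs)
  simp only
  linarith

/-- A subgradient at `t` gives equality in Young's inequality, so it is a competitor with value at
least `Φ t`. -/
theorem le_conjugate_conjugate (h : IsOrliczFunction Φ)
    (hsup : Tendsto (fun t => Φ t / t) atTop atTop) {t : ℝ} (ht : 0 ≤ t) :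
    Φ t ≤ conjugate (conjugate Φ) t := by
  obtain ⟨s, hs, hsub⟩ := h.exists_subgradient ht
  have h1 : conjugate Φ s ≤ t * s - Φ t := by
    refine csSup_le (nonempty_Ici.image _) ?_
    rintro _ ⟨u, hu, rfl⟩
    have := hsub u hu
    simp only
    linarith
  have h2 : s * t - conjugate Φ s ≤ conjugate (conjugate Φ) t :=
    le_csSup (bddAbove_conjugate_conjugate h hsup ht) ⟨s, hs, rfl⟩
  linarith

/-- In the supremum defining the conjugate, rational arguments suffice. -/
theorem conjugate_le_of_forall_rat (h : IsOrliczFunction Φ) {s r : ℝ} (hs : 0 ≤ s)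
    (hr : ∀ q : ℚ, (0 : ℝ) ≤ q → q * s - Φ q ≤ r) : conjugate Φ s ≤ r := by
  refine csSup_le (nonempty_Ici.image _) ?_
  rintro _ ⟨t, ht, rfl⟩
  simp only
  rcases (mem_Ici.1 ht).eq_or_lt with rfl | ht0
  · simpa using hr 0 (by simp)
  refine le_of_forall_pos_le_add fun ε hε => ?_
  -- Taking `q` just below `t` makes monotonicity give `Φ q ≤ Φ t`, so continuity is not needed. The
  -- `+ 1` allows `s = 0`.
  obtain ⟨q, hq1, hq2⟩ := exists_rat_btwn (max_lt ht0 (by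
    have : 0 < ε / (s + 1) := by positivity
    linarith : t - ε / (s + 1) < t))
  have hq0 := (le_max_left _ _).trans hq1.le
  have hq3 := (le_max_right _ _).trans hq1.le
  have h1 := hr q hq0
  have h2 := h.monotoneOn (mem_Ici.2 hq0) ht hq2.le
  have h3 : (t - q) * s ≤ ε := by
    calc (t - q) * s ≤ ε / (s + 1) * s := by gcongr; linarith
      _ ≤ ε := by rw [div_mul_eq_mul_div, div_le_iff₀ (by linarith)]; nlinarith
  linarith

end Functions

/-! ### Modulars, the Luxemburg norm and multiples of the unit ball -/

section Modular

variable {Φ : ℝ → ℝ} {Ω : Type*} [MeasurableSpace Ω] {P : Measure Ω}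

theorem modular_mono (h : IsOrliczFunction Φ) {c : ℝ} (hc : 0 < c) {X Y : Ω →ₘ[P] ℝ}
    (hXY : ∀ᵐ ω ∂P, |X ω| ≤ |Y ω|) : modular Φ c X ≤ modular Φ c Y := by
  refine lintegral_mono_ae ?_
  filter_upwards [hXY] with ω hω
  exact ENNReal.ofReal_le_ofReal (h.monotoneOn (mem_Ici.2 (by positivity))
    (mem_Ici.2 (by positivity)) (by gcongr))

theorem modular_anti (h : IsOrliczFunction Φ) {c d : ℝ} (hc : 0 < c) (hcd : c ≤ d)
    (X : Ω →ₘ[P] ℝ) : modular Φ d X ≤ modular Φ c X := by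
  refine lintegral_mono fun ω => ?_
  have hd := hc.trans_le hcd
  exact ENNReal.ofReal_le_ofReal (h.monotoneOn (mem_Ici.2 (by positivity))
    (mem_Ici.2 (by positivity)) (by gcongr))

theorem modular_smul (c : ℝ) {a : ℝ} (ha : 0 < a) (X : Ω →ₘ[P] ℝ) :
    modular Φ c (a • X) = modular Φ (c / a) X := by
  refine lintegral_congr_ae ?_
  filter_upwards [AEEqFun.coeFn_smul a X] with ω hω
  rw [hω, Pi.smul_apply, smul_eq_mul, abs_mul, abs_of_pos ha]
  congr 2
  field_simp

theorem modular_neg (c : ℝ) (X : Ω →ₘ[P] ℝ) : modular Φ c (-X) = modular Φ c X := by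
  refine lintegral_congr_ae ?_
  filter_upwards [AEEqFun.coeFn_neg X] with ω hω
  rw [hω, Pi.neg_apply, abs_neg]

/-- Convexity of the modular. -/
theorem modular_add_le_mul (h : IsOrliczFunction Φ) {c d : ℝ} (hc : 0 < c) (hd : 0 < d)
    (X Y : Ω →ₘ[P] ℝ) : modular Φ (c + d) (X + Y) ≤
      ENNReal.ofReal (c / (c + d)) * modular Φ c X +
        ENNReal.ofReal (d / (c + d)) * modular Φ d Y := by
  have hcd : 0 < c + d := add_pos hc hd
  have ha : 0 ≤ c / (c + d) := by positivity
  have hb : 0 ≤ d / (c + d) := by positivity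
  have hab : c / (c + d) + d / (c + d) = 1 := by field_simp
  calc modular Φ (c + d) (X + Y)
      ≤ ∫⁻ ω, (ENNReal.ofReal (c / (c + d)) * ENNReal.ofReal (Φ (|X ω| / c)) +
          ENNReal.ofReal (d / (c + d)) * ENNReal.ofReal (Φ (|Y ω| / d))) ∂P := by
        refine lintegral_mono_ae ?_
        filter_upwards [AEEqFun.coeFn_add X Y] with ω hω
        rw [hω, ← ENNReal.ofReal_mul ha, ← ENNReal.ofReal_mul hb, ← ENNReal.ofReal_add
          (mul_nonneg ha (h.nonneg (by positivity))) (mul_nonneg hb (h.nonneg (by positivity)))]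
        refine ENNReal.ofReal_le_ofReal ?_
        have hx : (0 : ℝ) ≤ |X ω| / c := by positivity
        have hy : (0 : ℝ) ≤ |Y ω| / d := by positivity
        refine le_trans ?_ (h.convexOn.2 hx hy ha hb hab)
        refine h.monotoneOn (mem_Ici.2 (by positivity)) (mem_Ici.2 (by positivity)) ?_
        have : c / (c + d) * (|X ω| / c) + d / (c + d) * (|Y ω| / d)
            = (|X ω| + |Y ω|) / (c + d) := by field_simp
        simp only [smul_eq_mul, this, Pi.add_apply]
        exact div_le_div_of_nonneg_right (abs_add_le _ _) hcd.le
    _ = _ := by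
        rw [lintegral_add_left' ((h.aemeasurable hc X).const_mul _),
          lintegral_const_mul' _ _ ENNReal.ofReal_ne_top,
          lintegral_const_mul' _ _ ENNReal.ofReal_ne_top, modular, modular]

theorem modular_add_le (h : IsOrliczFunction Φ) {c d : ℝ} (hc : 0 < c) (hd : 0 < d)
    (X Y : Ω →ₘ[P] ℝ) : modular Φ (c + d) (X + Y) ≤ modular Φ c X + modular Φ d Y := by
  have hcd : 0 < c + d := add_pos hc hd
  refine (modular_add_le_mul h hc hd X Y).trans (add_le_add ?_ ?_)
  · refine mul_le_of_le_one_left' (ENNReal.ofReal_le_one.2 ?_)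
    rw [div_le_one hcd]; linarith
  · refine mul_le_of_le_one_left' (ENNReal.ofReal_le_one.2 ?_)
    rw [div_le_one hcd]; linarith

/-- The modular balls are convex. -/
theorem modular_convexCombo_le (h : IsOrliczFunction Φ) {c : ℝ} (hc : 0 < c) {X Y : Ω →ₘ[P] ℝ}
    {r : ℝ≥0∞} (hX : modular Φ c X ≤ r) (hY : modular Φ c Y ≤ r) {a b : ℝ} (ha : 0 < a)
    (hb : 0 < b) (hab : a + b = 1) : modular Φ c (a • X + b • Y) ≤ r := by
  have := modular_add_le_mul h (mul_pos ha hc) (mul_pos hb hc) (a • X) (b • Y)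
  rw [← add_mul, hab, one_mul, modular_smul _ ha, modular_smul _ hb, mul_div_cancel_right₀ _ hc.ne',
    mul_div_cancel_right₀ _ hc.ne', mul_div_cancel_left₀ _ ha.ne',
    mul_div_cancel_left₀ _ hb.ne'] at this
  calc _ ≤ _ := this
    _ ≤ ENNReal.ofReal a * r + ENNReal.ofReal b * r := by gcongr
    _ = r := by rw [← add_mul, ← ENNReal.ofReal_add ha.le hb.le, hab, ENNReal.ofReal_one, one_mul]

/-- Since `Φ (a * t) ≤ a * Φ t` for `0 ≤ a ≤ 1`, enlarging the scale by a factor above the modular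
brings the modular below `1`. -/
theorem mem_orliczSpace_of_modular_lt_top (h : IsOrliczFunction Φ) {c : ℝ} (hc : 0 < c)
    {X : Ω →ₘ[P] ℝ} (hX : modular Φ c X < ⊤) : X ∈ orliczSpace h P := by
  obtain ⟨m, hm⟩ := ENNReal.exists_nat_gt hX.ne
  have hm1 : (0 : ℝ) < m + 1 := by positivity
  refine (luxemburgNorm_lt_top_iff _).2 ⟨c * (m + 1), by positivity, ?_⟩
  calc modular Φ (c * (m + 1)) X
      ≤ ∫⁻ ω, ENNReal.ofReal (1 / (m + 1)) * ENNReal.ofReal (Φ (|X ω| / c)) ∂P := by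
        refine lintegral_mono fun ω => ?_
        rw [← ENNReal.ofReal_mul (by positivity)]
        refine ENNReal.ofReal_le_ofReal ?_
        have : |X ω| / (c * (m + 1)) = 1 / (m + 1) * (|X ω| / c) := by field_simp
        simp only [this]
        refine h.map_mul_le (by positivity) ?_ (by positivity)
        rw [div_le_one hm1]; linarith [(Nat.cast_nonneg m : (0 : ℝ) ≤ m)]
    _ = ENNReal.ofReal (1 / (m + 1)) * modular Φ c X := by
        rw [lintegral_const_mul' _ _ ENNReal.ofReal_ne_top, modular]
    _ ≤ ENNReal.ofReal (1 / (m + 1)) * ENNReal.ofReal (m + 1) := by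
        gcongr
        refine hm.le.trans ?_
        rw [← ENNReal.ofReal_natCast]
        exact ENNReal.ofReal_le_ofReal (by linarith)
    _ = 1 := by
        rw [← ENNReal.ofReal_mul (by positivity), one_div, inv_mul_cancel₀ hm1.ne',
          ENNReal.ofReal_one]

/-- Asking only for scales strictly above `k` avoids the question whether the infimum is attained,
and includes `k = 0`. -/
theorem luxemburgNorm_le_iff (h : IsOrliczFunction Φ) {k : ℝ} (hk : 0 ≤ k) (X : Ω →ₘ[P] ℝ) :
    luxemburgNorm Φ X ≤ ENNReal.ofReal k ↔ ∀ c, k < c → modular Φ c X ≤ 1 := by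
  constructor
  · intro hX c hc
    have h1 : luxemburgNorm Φ X < ENNReal.ofReal c :=
      hX.trans_lt ((ENNReal.ofReal_lt_ofReal_iff (hk.trans_lt hc)).2 hc)
    simp only [luxemburgNorm, iInf_lt_iff] at h1
    obtain ⟨d, ⟨hd, hdX⟩, hdc⟩ := h1
    exact (modular_anti h hd ((ENNReal.ofReal_lt_ofReal_iff (hk.trans_lt hc)).1 hdc).le X).trans hdX
  · intro hX
    refine le_of_forall_gt fun r hr => ?_
    obtain ⟨c, hc1, hc2⟩ := ENNReal.lt_iff_exists_real_btwn.1 hr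
    have hkc : k < c := by
      by_contra! hcon
      exact absurd hc2.1 (not_lt.2 (ENNReal.ofReal_le_ofReal hcon))
    exact (iInf₂_le c ⟨hk.trans_lt hkc, hX c hkc⟩).trans_lt hc2.2

theorem mem_smul_unitBall_iff (h : IsOrliczFunction Φ) {k : ℝ} (hk : 0 < k)
    (X : orliczSpace h P) : X ∈ k • unitBall h P ↔ ∀ c, k < c → modular Φ c X.1 ≤ 1 := by
  rw [mem_smul_set_iff_inv_smul_mem₀ hk.ne', unitBall, mem_ofPred_eq, ← ENNReal.ofReal_one,
    luxemburgNorm_le_iff h zero_le_one, ENNReal.ofReal_one]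
  have hmod : ∀ c, modular Φ c (k⁻¹ • X : orliczSpace h P).1 = modular Φ (c * k) X.1 := fun c => by
    rw [Submodule.coe_smul, modular_smul _ (inv_pos.2 hk), div_inv_eq_mul]
  simp only [hmod]
  constructor
  · intro H c hc
    have := H (c / k) ((one_lt_div hk).2 hc)
    rwa [div_mul_cancel₀ _ hk.ne'] at this
  · intro H c hc
    exact H _ (by nlinarith)

theorem convex_smul_unitBall (h : IsOrliczFunction Φ) {k : ℝ} (hk : 0 < k) :
    Convex ℝ (k • unitBall h P) := by
  refine convex_iff_forall_pos.2 fun X hX Y hY a b ha hb hab => ?_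
  rw [mem_smul_unitBall_iff h hk] at hX hY ⊢
  exact fun c hc => modular_convexCombo_le h (hk.trans hc) (hX c hc) (hY c hc) ha hb hab

end Modular

/-! ### From a bound on pairings to a bound on the conjugate modular -/

section Duality

variable {Φ : ℝ → ℝ} {Ω : Type*} [MeasurableSpace Ω] {P : Measure Ω}

theorem integrable_mul_simpleFunc {X : Ω → ℝ} (hX : Integrable X P) (U : SimpleFunc Ω ℝ) :
    Integrable (fun ω => X ω * U ω) P := by
  obtain ⟨C, hC⟩ := U.exists_forall_norm_le
  exact hX.mul_bdd (c := C) U.aestronglyMeasurable (Eventually.of_forall hC)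

theorem integrable_comp_simpleFunc [IsFiniteMeasure P] (g : ℝ → ℝ) (U : SimpleFunc Ω ℝ) :
    Integrable (fun ω => g (U ω)) P :=
  (U.map g).integrable_of_isFiniteMeasure

/-- Simple functions that are nearly optimal in the supremum defining the conjugate. -/
theorem exists_simpleFunc_selection (hΦ : IsOrliczFunction Φ) {s : Ω → ℝ} (hs : Measurable s)
    (q : ℕ → ℝ) (hq : ∀ n, 0 ≤ q n) :
    ∃ U : ℕ → SimpleFunc Ω ℝ, ∀ n ω, 0 ≤ U n ω ∧ 0 ≤ U n ω * s ω - Φ (U n ω) ∧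
      ∀ j < n, q j * s ω - Φ (q j) ≤ U n ω * s ω - Φ (U n ω) := by
  -- The update `f n` replaces `V` by the constant `q n` wherever that gives a larger gain.
  -- Iterating from `0`, whose gain is `0`, keeps the gain nonnegative.
  choose f hf using fun (n : ℕ) (V : SimpleFunc Ω ℝ) =>
    (⟨V.piecewise {ω | q n * s ω - Φ (q n) ≤ V ω * s ω - Φ (V ω)}
      (measurableSet_le ((hs.const_mul _).sub_const _)
        ((V.measurable.mul hs).sub (V.map Φ).measurable)) (SimpleFunc.const Ω (q n)), rfl⟩ :
      ∃ W : SimpleFunc Ω ℝ, W = SimpleFunc.piecewise _ _ V (SimpleFunc.const Ω (q n)))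
  have key : ∀ n V ω, (f n V ω = V ω ∧ q n * s ω - Φ (q n) ≤ V ω * s ω - Φ (V ω)) ∨
      (f n V ω = q n ∧ V ω * s ω - Φ (V ω) < q n * s ω - Φ (q n)) := by
    intro n V ω
    rw [hf]
    simp only [SimpleFunc.coe_piecewise, Set.piecewise, mem_ofPred_eq]
    split_ifs with h
    · exact Or.inl ⟨rfl, h⟩
    · exact Or.inr ⟨rfl, not_le.1 h⟩
  refine ⟨fun n => Nat.rec 0 f n, fun n => ?_⟩
  induction n with
  | zero => intro ω; simp [hΦ.map_zero]
  | succ n ih =>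
    intro ω
    obtain ⟨h1, h2, h3⟩ := ih ω
    set V : SimpleFunc Ω ℝ := Nat.rec 0 f n
    change 0 ≤ f n V ω ∧ 0 ≤ f n V ω * s ω - Φ (f n V ω) ∧
      ∀ j < n + 1, q j * s ω - Φ (q j) ≤ f n V ω * s ω - Φ (f n V ω)
    rcases key n V ω with ⟨he, hle⟩ | ⟨he, hlt⟩ <;> rw [he]
    · refine ⟨h1, h2, fun j hj => ?_⟩
      rcases Nat.lt_succ_iff_lt_or_eq.1 hj with hj | rfl
      exacts [h3 j hj, hle]
    · refine ⟨hq n, h2.trans hlt.le, fun j hj => ?_⟩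
      rcases Nat.lt_succ_iff_lt_or_eq.1 hj with hj | rfl
      exacts [(h3 j hj).trans hlt.le, le_rfl]

/-- A function whose pairing with simple functions `U` grows at most like `E[Φ(|U|)]` has
finite modular for the conjugate function. -/
theorem lintegral_conjugate_le_one [IsFiniteMeasure P] (hΦ : IsOrliczFunction Φ)
    {X : Ω → ℝ} (hXm : Measurable X) (hX : Integrable X P) {K : ℝ} (hK : 0 < K)
    (H : ∀ U : SimpleFunc Ω ℝ, ∫ ω, X ω * U ω ∂P ≤ K * (1 + ∫ ω, Φ |U ω| ∂P)) :
    ∫⁻ ω, ENNReal.ofReal (conjugate Φ (|X ω| / K)) ∂P ≤ 1 := by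
  have hs : Measurable fun ω => |X ω| / K := hXm.abs.div_const K
  obtain ⟨e, he⟩ := exists_surjective_nat ℚ
  obtain ⟨U, hU⟩ := exists_simpleFunc_selection hΦ hs (fun n => max (e n : ℝ) 0)
    (fun n => le_max_right _ _)
  have hmeas : ∀ n, Measurable fun ω =>
      ENNReal.ofReal (U n ω * (|X ω| / K) - Φ (U n ω)) := fun n =>
    (((U n).measurable.mul hs).sub ((U n).map Φ).measurable).ennreal_ofReal
  have hint : ∀ n, Integrable (fun ω => U n ω * (|X ω| / K)) P := fun n => by
    simpa only [mul_comm] using integrable_mul_simpleFunc (hX.abs.div_const K) (U n)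
  have hbound : ∀ n, ∫⁻ ω, ENNReal.ofReal (U n ω * (|X ω| / K) - Φ (U n ω)) ∂P ≤ 1 := by
    intro n
    have hsub : Integrable (fun ω => U n ω * (|X ω| / K) - Φ (U n ω)) P :=
      (hint n).sub (integrable_comp_simpleFunc Φ (U n))
    rw [← ofReal_integral_eq_lintegral_ofReal hsub
      (Eventually.of_forall fun ω => (hU n ω).2.1), ENNReal.ofReal_le_one,
      integral_sub (hint n) (integrable_comp_simpleFunc Φ (U n))]
    -- `V` is `U n` with the sign of `X`, so that `X V = |X| U n` and `|V| = U n`.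
    set V : SimpleFunc Ω ℝ := SimpleFunc.piecewise {ω | 0 ≤ X ω}
      (measurableSet_le measurable_const hXm) (U n) (-U n) with hV
    have hVω : ∀ ω, X ω * V ω = K * (U n ω * (|X ω| / K)) ∧ |V ω| = U n ω := by
      intro ω
      have h1 : K * (U n ω * (|X ω| / K)) = U n ω * |X ω| := by field_simp
      rw [h1]
      simp only [hV, SimpleFunc.coe_piecewise, Set.piecewise, mem_ofPred_eq]
      split_ifs with h
      · rw [abs_of_nonneg h, abs_of_nonneg (hU n ω).1]
        exact ⟨mul_comm _ _, rfl⟩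
      · rw [abs_of_neg (not_le.1 h)]
        simp only [SimpleFunc.coe_neg, Pi.neg_apply, abs_neg, abs_of_nonneg (hU n ω).1]
        exact ⟨by ring, trivial⟩
    have h2 := H V
    simp only [hVω] at h2
    rw [integral_const_mul, mul_le_mul_iff_right₀ hK] at h2
    linarith
  -- Each rational competitor is beaten from some index on, so the conjugate lies below the liminf
  -- of the gains, and Fatou's lemma applies.
  calc ∫⁻ ω, ENNReal.ofReal (conjugate Φ (|X ω| / K)) ∂P
      ≤ ∫⁻ ω, liminf (fun n => ENNReal.ofReal (U n ω * (|X ω| / K) - Φ (U n ω))) atTop ∂P := by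
        refine lintegral_mono fun ω => ?_
        rcases eq_or_ne (liminf (fun n => ENNReal.ofReal (U n ω * (|X ω| / K) - Φ (U n ω)))
          atTop) ⊤ with htop | htop
        · simp only [htop, le_top]
        refine ENNReal.ofReal_le_of_le_toReal
          (conjugate_le_of_forall_rat hΦ (by positivity) fun r hr => ?_)
        obtain ⟨j, rfl⟩ := he r
        refine (ENNReal.ofReal_le_iff_le_toReal htop).1
          (le_liminf_of_le (by isBoundedDefault) ?_)
        filter_upwards [eventually_gt_atTop j] with n hn
        have := (hU n ω).2.2 j hn
        rw [max_eq_left hr] at this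
        exact ENNReal.ofReal_le_ofReal this
    _ ≤ liminf (fun n => ∫⁻ ω, ENNReal.ofReal (U n ω * (|X ω| / K) - Φ (U n ω)) ∂P) atTop :=
        lintegral_liminf_le hmeas
    _ ≤ 1 := (liminf_le_liminf (Eventually.of_forall hbound)).trans (by simp)

end Duality

/-! ### Radon–Nikodym representation of modularly dominated functionals -/

section Representation

variable {Φ : ℝ → ℝ} {Ω : Type*} [MeasurableSpace Ω] {P : Measure Ω}

open Classical in
/-- The indicator function of a measurable set as a simple function. -/
noncomputable def indicatorSimple (A : Set Ω) : SimpleFunc Ω ℝ :=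
  if hA : MeasurableSet A then SimpleFunc.piecewise A hA (SimpleFunc.const Ω 1) 0 else 0

theorem indicatorSimple_apply {A : Set Ω} (hA : MeasurableSet A) (ω : Ω) :
    indicatorSimple A ω = A.indicator 1 ω := by
  classical
  rw [indicatorSimple, dif_pos hA, SimpleFunc.coe_piecewise]
  simp [Set.piecewise, Set.indicator]

theorem indicatorSimple_of_not {A : Set Ω} (hA : ¬ MeasurableSet A) :
    indicatorSimple A = (0 : SimpleFunc Ω ℝ) := dif_neg hA

theorem indicatorSimple_union {A B : Set Ω} (hA : MeasurableSet A) (hB : MeasurableSet B)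
    (hAB : Disjoint A B) : indicatorSimple (A ∪ B) = indicatorSimple A + indicatorSimple B := by
  ext ω
  rw [SimpleFunc.add_apply, indicatorSimple_apply (hA.union hB), indicatorSimple_apply hA,
    indicatorSimple_apply hB, Set.indicator_union_of_disjoint hAB]

/-- A linear functional on simple functions that is dominated by the modular is absolutely
continuous. -/
theorem exists_pos_forall_measure_lt [IsFiniteMeasure P] (hΦ : IsOrliczFunction Φ)
    (f : SimpleFunc Ω ℝ →ₗ[ℝ] ℝ) {K : ℝ} (hK : 0 < K)
    (H : ∀ U : SimpleFunc Ω ℝ, f U ≤ K * (1 + ∫ ω, Φ |U ω| ∂P)) {ε : ℝ} (hε : 0 < ε) :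
    ∃ η > 0, ∀ A, MeasurableSet A → P.real A ≤ η → |f (indicatorSimple A)| ≤ ε := by
  -- The bound is tested on `±r` times the indicator. If `P(A) Φ(r) ≤ 1`, then `r |f(1_A)| ≤ 2K = r
  -- ε`.
  set r := 2 * K / ε with hr
  have hr0 : 0 < r := by positivity
  have hΦr := hΦ.nonneg hr0.le
  refine ⟨1 / (Φ r + 1), by positivity, fun A hA hPA => ?_⟩
  have h1 : ∀ a : ℝ, |a| = r → a * f (indicatorSimple A) ≤ 2 * K := by
    intro a ha
    have h2 := H (a • indicatorSimple A)
    have h3 : ∀ ω, Φ |(a • indicatorSimple A) ω| = A.indicator (fun _ => Φ r) ω := fun ω => by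
      rw [SimpleFunc.coe_smul, Pi.smul_apply, indicatorSimple_apply hA]
      by_cases hω : ω ∈ A <;> simp [hω, hΦ.map_zero, ha]
    simp only [h3, map_smul, smul_eq_mul] at h2
    rw [integral_indicator hA, setIntegral_const, smul_eq_mul] at h2
    have h4 : P.real A * Φ r ≤ 1 := by
      calc P.real A * Φ r ≤ 1 / (Φ r + 1) * Φ r := by gcongr
        _ ≤ 1 := by rw [div_mul_eq_mul_div, div_le_one (by positivity)]; linarith
    nlinarith
  have h5 := h1 r (abs_of_pos hr0)
  have h6 := h1 (-r) (by rw [abs_neg, abs_of_pos hr0])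
  have h7 : r * ε = 2 * K := by rw [hr]; field_simp
  rw [abs_le]
  constructor <;> nlinarith

/-- Riesz representation of functionals on simple functions that are dominated by the modular. -/
theorem exists_density [IsFiniteMeasure P] (hΦ : IsOrliczFunction Φ)
    (f : SimpleFunc Ω ℝ →ₗ[ℝ] ℝ) {K : ℝ} (hK : 0 < K)
    (H : ∀ U : SimpleFunc Ω ℝ, f U ≤ K * (1 + ∫ ω, Φ |U ω| ∂P)) :
    ∃ Y : Ω → ℝ, Measurable Y ∧ Integrable Y P ∧ ∀ U : SimpleFunc Ω ℝ, f U = ∫ ω, Y ω * U ω ∂P := by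
  have hunion : ∀ A B, MeasurableSet A → MeasurableSet B → Disjoint A B →
      f (indicatorSimple (A ∪ B)) = f (indicatorSimple A) + f (indicatorSimple B) :=
    fun A B hA hB hAB => by rw [indicatorSimple_union hA hB hAB, map_add]
  have hempty : f (indicatorSimple ∅) = 0 := by
    have := hunion ∅ ∅ MeasurableSet.empty MeasurableSet.empty (disjoint_empty _)
    rw [union_empty] at this
    linarith
  let ν : SignedMeasure Ω :=
    { measureOf' := fun A => f (indicatorSimple A)
      empty' := hempty
      not_measurable' := fun A hA => by rw [indicatorSimple_of_not hA, map_zero]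
      m_iUnion' := by
        intro A hA hdisj
        have hpart : ∀ s : Finset ℕ, f (indicatorSimple (⋃ i ∈ s, A i))
            = ∑ i ∈ s, f (indicatorSimple (A i)) := by
          intro s
          induction s using Finset.induction_on with
          | empty => simpa using hempty
          | insert i s his ih =>
            rw [Finset.set_biUnion_insert, Finset.sum_insert his, ← ih]
            refine hunion _ _ (hA i) (s.measurableSet_biUnion fun j _ => hA j) ?_
            refine disjoint_iUnion₂_right.2 fun j hj => hdisj ?_
            rintro rfl
            exact his hj
        have hsum : HasSum (fun i => P.real (A i)) (P.real (⋃ i, A i)) := by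
          have h1 := measure_iUnion (μ := P) hdisj hA
          have h2 : Summable fun i => P.real (A i) :=
            ENNReal.summable_toReal (h1 ▸ measure_ne_top P _)
          have h3 : P.real (⋃ i, A i) = ∑' i, P.real (A i) := by
            rw [Measure.real, h1, ENNReal.tsum_toReal_eq fun i => measure_ne_top P _]
            rfl
          rw [h3]
          exact h2.hasSum
        -- Countable additivity: the part of the union missed by a large finite set of indices has
        -- small measure, so `f` is small on it.
        refine Metric.tendsto_nhds.2 fun ε hε => ?_
        obtain ⟨η, hη, hfη⟩ := exists_pos_forall_measure_lt hΦ f hK H (half_pos hε)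
        filter_upwards [Metric.tendsto_nhds.1 hsum η hη] with s hs
        have hms : MeasurableSet (⋃ i ∈ s, A i) := s.measurableSet_biUnion fun j _ => hA j
        have hmU : MeasurableSet (⋃ i, A i) := MeasurableSet.iUnion hA
        have hsub : (⋃ i ∈ s, A i) ⊆ ⋃ i, A i := iUnion₂_subset fun i _ => subset_iUnion A i
        have h1 := hunion _ _ hms (hmU.diff hms) disjoint_sdiff_right
        rw [union_sdiff_cancel hsub, hpart] at h1
        have h2 : P.real ((⋃ i, A i) \ ⋃ i ∈ s, A i)
            = P.real (⋃ i, A i) - ∑ i ∈ s, P.real (A i) := by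
          rw [measureReal_sdiff hsub hms, measureReal_biUnion_finset
            (fun i _ j _ hij => hdisj hij) fun i _ => hA i]
        have h3 := hfη _ (hmU.diff hms) (by
          rw [h2]
          rw [Real.dist_eq, abs_sub_comm] at hs
          exact (le_abs_self _).trans hs.le)
        rw [Real.dist_eq, abs_sub_comm, h1, add_sub_cancel_left]
        linarith }
  have hν : ∀ A, ν A = f (indicatorSimple A) := fun A => rfl
  have hac : ν ≪ᵥ P.toENNRealVectorMeasure := by
    refine VectorMeasure.AbsolutelyContinuous.mk fun A hA hPA => ?_
    rw [Measure.toENNRealVectorMeasure_apply_measurable hA] at hPA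
    rw [hν, ← abs_nonpos_iff]
    refine le_of_forall_pos_le_add fun ε hε => ?_
    obtain ⟨η, hη, hfη⟩ := exists_pos_forall_measure_lt hΦ f hK H hε
    rw [zero_add]
    exact hfη A hA (by simp [Measure.real, hPA, hη.le])
  have hdens := SignedMeasure.withDensityᵥ_rnDeriv_eq ν P hac
  have hYi := SignedMeasure.integrable_rnDeriv ν P
  refine ⟨ν.rnDeriv P, SignedMeasure.measurable_rnDeriv ν P, hYi, fun U => ?_⟩
  have hind : ∀ A, MeasurableSet A → f (indicatorSimple A)
      = ∫ ω, ν.rnDeriv P ω * indicatorSimple A ω ∂P := by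
    intro A hA
    rw [← hν, ← hdens, withDensityᵥ_apply hYi hA, ← integral_indicator hA, hdens]
    refine integral_congr_ae (Eventually.of_forall fun ω => ?_)
    simp only [indicatorSimple_apply hA]
    by_cases hω : ω ∈ A <;> simp [hω]
  induction U using SimpleFunc.induction with
  | const c hA =>
    rename_i A
    have : SimpleFunc.piecewise A hA (SimpleFunc.const Ω c) (SimpleFunc.const Ω 0)
        = c • indicatorSimple A := by
      ext ω
      rw [SimpleFunc.coe_smul, Pi.smul_apply, indicatorSimple_apply hA]
      by_cases hω : ω ∈ A <;> simp [hω]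
    rw [this, map_smul, hind A hA, smul_eq_mul, ← integral_const_mul]
    refine integral_congr_ae (Eventually.of_forall fun ω => ?_)
    simp only [SimpleFunc.coe_smul, Pi.smul_apply, smul_eq_mul]
    ring
  | add _ hU hV =>
    rename_i U V _
    rw [map_add, hU, hV, ← integral_add (integrable_mul_simpleFunc hYi U)
      (integrable_mul_simpleFunc hYi V)]
    simp only [SimpleFunc.coe_add, Pi.add_apply, mul_add]

end Representation

/-- Algebraic separation of disjoint convex sets, one of which is absorbent. -/
theorem exists_linearMap_separating {E : Type*} [AddCommGroup E] [Module ℝ E] {s t : Set E}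
    (hs : Convex ℝ s) (hs0 : Absorbent ℝ s) (ht : Convex ℝ t) (htne : t.Nonempty)
    (hst : Disjoint s t) :
    ∃ f : E →ₗ[ℝ] ℝ, (∃ γ > 0, ∀ x ∈ t, γ ≤ f x) ∧ ∀ x ∈ s, f x ≤ 1 := by
  obtain ⟨x₀, hx₀⟩ := htne
  have h0 : (0 : E) ∈ s := hs0.zero_mem
  have hx₀s : x₀ ∉ s := fun h => disjoint_left.1 hst h hx₀
  have hne : x₀ ≠ 0 := fun h => hx₀s (h ▸ h0)
  -- `S` contains `s`, hence is absorbent, and misses `x₀`. Its gauge therefore dominates the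
  -- functional `x₀ ↦ 1` on the line through `x₀`.
  set S : Set E := s - t + {x₀} with hS
  have hSc : Convex ℝ S := (hs.sub ht).add (convex_singleton x₀)
  have hmem : ∀ x ∈ s, ∀ y ∈ t, x - y + x₀ ∈ S := fun x hx y hy =>
    add_mem_add (sub_mem_sub hx hy) rfl
  have hsS : s ⊆ S := fun x hx => by simpa using hmem x hx x₀ hx₀
  have hS0 : Absorbent ℝ S := hs0.mono hsS
  have hx₀S : x₀ ∉ S := by
    rintro ⟨z, ⟨x, hx, y, hy, rfl⟩, w, rfl, hw⟩
    have : x = y := by simpa [sub_eq_zero] using hw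
    exact disjoint_left.1 hst hx (this ▸ hy)
  let g : E →ₗ.[ℝ] ℝ := LinearPMap.mkSpanSingleton x₀ 1 hne
  obtain ⟨f, hf1, hf2⟩ := exists_extension_of_le_sublinear g (gauge S)
    (fun c hc => gauge_smul_of_nonneg hc.le) (gauge_add_le hSc hS0) (by
      rintro ⟨x, hx⟩
      obtain ⟨y, rfl⟩ := Submodule.mem_span_singleton.1 hx
      rw [LinearPMap.mkSpanSingleton'_apply]
      simp only [smul_eq_mul, mul_one, RingHom.id_apply]
      obtain h | h := le_or_gt y 0
      · exact h.trans (gauge_nonneg _)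
      · rw [gauge_smul_of_nonneg h.le, smul_eq_mul, le_mul_iff_one_le_right h]
        exact one_le_gauge_of_notMem (hSc.starConvex (hsS h0)) (hS0.absorbs) hx₀S)
  have hfx₀ : f x₀ = 1 := by
    have := hf1 ⟨x₀, Submodule.mem_span_singleton_self _⟩
    exact this.trans (LinearPMap.mkSpanSingleton'_apply_self _ _ _ _)
  have hfle : ∀ x ∈ s, ∀ y ∈ t, f x ≤ f y := fun x hx y hy => by
    have := (hf2 _).trans (gauge_le_one_of_mem (hmem x hx y hy))
    rw [map_add, map_sub, hfx₀] at this
    linarith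
  refine ⟨f, ?_, fun x hx => hfx₀ ▸ hfle x hx x₀ hx₀⟩
  -- As `r⁻¹ x₀ ∈ s`, the value `r⁻¹` is a positive lower bound for `f` on `t`.
  obtain ⟨r, hr, hrs⟩ := (hs0.absorbs (x := x₀)).exists_pos
  have h1 := hrs r (le_abs_self r) (mem_singleton x₀)
  rw [mem_smul_set_iff_inv_smul_mem₀ hr.ne'] at h1
  refine ⟨r⁻¹, inv_pos.2 hr, fun y hy => ?_⟩
  have := hfle _ h1 y hy
  rwa [map_smul, hfx₀, smul_eq_mul, mul_one] at this

/-! ### Simple functions and separation in the modular -/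

section Simple

variable {Φ : ℝ → ℝ} {Ω : Type*} [MeasurableSpace Ω] {P : Measure Ω}

/-- The class of a simple function modulo almost sure equality. -/
noncomputable def simpleToAEEqFun (P : Measure Ω) (U : SimpleFunc Ω ℝ) : Ω →ₘ[P] ℝ :=
  AEEqFun.mk U U.aestronglyMeasurable

theorem coeFn_simpleToAEEqFun (U : SimpleFunc Ω ℝ) : simpleToAEEqFun P U =ᵐ[P] U :=
  AEEqFun.coeFn_mk _ _

theorem simpleToAEEqFun_smul_add_smul (a b : ℝ) (U V : SimpleFunc Ω ℝ) :
    simpleToAEEqFun P (a • U + b • V) = a • simpleToAEEqFun P U + b • simpleToAEEqFun P V := rfl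

theorem modular_simpleToAEEqFun [IsFiniteMeasure P] (h : IsOrliczFunction Φ)
    (U : SimpleFunc Ω ℝ) :
    modular Φ 1 (simpleToAEEqFun P U) = ENNReal.ofReal (∫ ω, Φ |U ω| ∂P) := by
  rw [ofReal_integral_eq_lintegral_ofReal (integrable_comp_simpleFunc (fun t => Φ |t|) U)
    (Eventually.of_forall fun ω => h.nonneg (abs_nonneg _))]
  refine lintegral_congr_ae ?_
  filter_upwards [coeFn_simpleToAEEqFun (P := P) U] with ω hω
  rw [hω, div_one]

theorem simpleToAEEqFun_mem [IsFiniteMeasure P] (h : IsOrliczFunction Φ) (U : SimpleFunc Ω ℝ) :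
    simpleToAEEqFun P U ∈ orliczSpace h P :=
  mem_orliczSpace_of_modular_lt_top h one_pos (by
    rw [modular_simpleToAEEqFun h]; exact ENNReal.ofReal_lt_top)

/-- Approximation of an element of finite modular by simple functions, with respect to the
modular and a given functional. -/
theorem exists_simpleFunc_approx (h : IsOrliczFunction Φ) (W : Ω →ₘ[P] ℝ)
    (hW : modular Φ 1 W < ⊤) {Y : Ω → ℝ} (hY : AEStronglyMeasurable Y P)
    (hWY : Integrable (fun ω => W ω * Y ω) P) :
    ∃ U : ℕ → SimpleFunc Ω ℝ,
      Tendsto (fun n => modular Φ 1 (W - simpleToAEEqFun P (U n))) atTop (𝓝 0) ∧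
      Tendsto (fun n => ∫ ω, Y ω * U n ω ∂P) atTop (𝓝 (∫ ω, W ω * Y ω ∂P)) := by
  have hWm : Measurable W := W.stronglyMeasurable.measurable
  -- The base point `0` ensures `|W - U n| ≤ |W|`, the domination used for both limits.
  set U : ℕ → SimpleFunc Ω ℝ := SimpleFunc.approxOn W hWm univ 0 (mem_univ _)
  have hlim : ∀ ω, Tendsto (fun n => U n ω) atTop (𝓝 (W ω)) := fun ω =>
    SimpleFunc.tendsto_approxOn hWm (mem_univ _) (by simp)
  have hdist : ∀ n ω, |W ω - U n ω| ≤ |W ω| := fun n ω => by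
    have := SimpleFunc.edist_approxOn_le hWm (mem_univ (0 : ℝ)) ω n
    rw [edist_dist, edist_dist, ENNReal.ofReal_le_ofReal_iff dist_nonneg, Real.dist_eq,
      Real.dist_eq, zero_sub, abs_neg, abs_sub_comm] at this
    exact this
  refine ⟨U, ?_, ?_⟩
  · have hsub : ∀ n, ∀ᵐ ω ∂P, (W - simpleToAEEqFun P (U n)) ω = W ω - U n ω := fun n => by
      filter_upwards [AEEqFun.coeFn_sub W (simpleToAEEqFun P (U n)),
        coeFn_simpleToAEEqFun (P := P) (U n)] with ω h1 h2
      rw [h1, Pi.sub_apply, h2]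
    have := tendsto_lintegral_of_dominated_convergence' (μ := P)
      (F := fun n ω => ENNReal.ofReal (Φ (|(W - simpleToAEEqFun P (U n)) ω| / 1))) (f := 0)
      (fun ω => ENNReal.ofReal (Φ (|W ω| / 1)))
      (fun n => h.aemeasurable one_pos _) (fun n => by
        filter_upwards [hsub n] with ω hω
        rw [hω, div_one, div_one]
        exact ENNReal.ofReal_le_ofReal (h.monotoneOn (mem_Ici.2 (abs_nonneg _))
          (mem_Ici.2 (abs_nonneg _)) (hdist n ω))) hW.ne (by
        filter_upwards [ae_all_iff.2 hsub] with ω hω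
        simp only [hω, div_one]
        have h1 : Tendsto (fun n => |W ω - U n ω|) atTop (𝓝 0) := by
          simpa using ((tendsto_const_nhds (x := W ω)).sub (hlim ω)).abs
        simpa using ENNReal.tendsto_ofReal (h.tendsto_zero (fun n => abs_nonneg _) h1))
    simpa [modular] using this
  · refine tendsto_integral_of_dominated_convergence (fun ω => 2 * ‖W ω * Y ω‖)
      (fun n => hY.mul (U n).aestronglyMeasurable) (hWY.norm.const_mul 2)
      (fun n => Eventually.of_forall fun ω => ?_) (Eventually.of_forall fun ω => ?_)
    · have h1 : |U n ω| ≤ 2 * |W ω| := by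
        have := abs_sub_abs_le_abs_sub (U n ω) (W ω)
        rw [abs_sub_comm] at this
        linarith [hdist n ω]
      rw [norm_mul, norm_mul, Real.norm_eq_abs, Real.norm_eq_abs, Real.norm_eq_abs]
      nlinarith [abs_nonneg (Y ω)]
    · rw [mul_comm]
      exact (hlim ω).const_mul (Y ω)

/-- The simple functions of small modular form a convex set. -/
theorem convex_simpleFunc_modular_lt [IsFiniteMeasure P] (h : IsOrliczFunction Φ) (δ : ℝ) :
    Convex ℝ {U : SimpleFunc Ω ℝ | ∫ ω, Φ |U ω| ∂P < δ} := by
  have hi := fun U : SimpleFunc Ω ℝ => integrable_comp_simpleFunc (P := P) (fun t => Φ |t|) U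
  have hconv : ConvexOn ℝ univ fun U : SimpleFunc Ω ℝ => ∫ ω, Φ |U ω| ∂P := by
    refine ⟨convex_univ, fun U _ V _ a b ha hb hab => ?_⟩
    simp only [smul_eq_mul]
    rw [← integral_const_mul, ← integral_const_mul,
      ← integral_add ((hi U).const_mul a) ((hi V).const_mul b)]
    refine integral_mono (hi _) (((hi U).const_mul a).add ((hi V).const_mul b)) fun ω => ?_
    refine le_trans ?_ (h.convexOn.2 (mem_Ici.2 (abs_nonneg (U ω)))
      (mem_Ici.2 (abs_nonneg (V ω))) ha hb hab)
    refine h.monotoneOn (mem_Ici.2 (abs_nonneg _)) (mem_Ici.2 ?_) ?_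
    · simp only [smul_eq_mul]; positivity
    · simp only [SimpleFunc.coe_add, SimpleFunc.coe_smul, Pi.add_apply, Pi.smul_apply, smul_eq_mul]
      refine (abs_add_le _ _).trans ?_
      rw [abs_mul, abs_mul, abs_of_nonneg ha, abs_of_nonneg hb]
  simpa using hconv.convex_lt δ

theorem integral_map_smul_le [IsFiniteMeasure P] (h : IsOrliczFunction Φ) {a : ℝ} (ha : |a| ≤ 1)
    (U : SimpleFunc Ω ℝ) : ∫ ω, Φ |(a • U) ω| ∂P ≤ |a| * ∫ ω, Φ |U ω| ∂P := by
  rw [← integral_const_mul]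
  refine integral_mono (integrable_comp_simpleFunc (fun t => Φ |t|) _)
    ((integrable_comp_simpleFunc (fun t => Φ |t|) _).const_mul _) fun ω => ?_
  simp only [SimpleFunc.coe_smul, Pi.smul_apply, smul_eq_mul, abs_mul]
  exact h.map_mul_le (abs_nonneg _) ha (abs_nonneg _)

theorem absorbent_simpleFunc_modular_lt [IsFiniteMeasure P] (h : IsOrliczFunction Φ) {δ : ℝ}
    (hδ : 0 < δ) : Absorbent ℝ {U : SimpleFunc Ω ℝ | ∫ ω, Φ |U ω| ∂P < δ} := by
  refine fun U => absorbs_iff_norm.2 ?_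
  set m := ∫ ω, Φ |U ω| ∂P
  have hm : 0 ≤ m := integral_nonneg fun ω => h.nonneg (abs_nonneg _)
  refine ⟨m / δ + 1, fun c hc => ?_⟩
  rw [Real.norm_eq_abs] at hc
  have hmd : 0 ≤ m / δ := by positivity
  have hc0 : 0 < |c| := by linarith
  rw [singleton_subset_iff, mem_smul_set_iff_inv_smul_mem₀ (abs_pos.1 hc0), mem_ofPred_eq]
  refine (integral_map_smul_le h (by rw [abs_inv]; exact inv_le_one_of_one_le₀ (by linarith))
    U).trans_lt ?_
  rw [abs_inv, inv_mul_lt_iff₀ hc0]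
  have : m / δ < |c| := by linarith
  rwa [div_lt_iff₀ hδ] at this

/-- A linear functional on simple functions that is bounded above on a modular ball grows at most
like the modular. -/
theorem exists_le_mul_one_add_modular [IsFiniteMeasure P] (h : IsOrliczFunction Φ)
    (f : SimpleFunc Ω ℝ →ₗ[ℝ] ℝ) {δ : ℝ} (hδ : 0 < δ)
    (H : ∀ U : SimpleFunc Ω ℝ, ∫ ω, Φ |U ω| ∂P < δ → f U ≤ 1) :
    ∃ K > 0, ∀ U : SimpleFunc Ω ℝ, f U ≤ K * (1 + ∫ ω, Φ |U ω| ∂P) := by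
  have hd : 0 < min δ 1 := lt_min hδ one_pos
  refine ⟨1 / min δ 1, by positivity, fun U => ?_⟩
  set m := ∫ ω, Φ |U ω| ∂P
  have hm : 0 ≤ m := integral_nonneg fun ω => h.nonneg (abs_nonneg _)
  -- Since `a ≤ 1`, the modular of `a • U` is at most `a * m < δ`.
  set a := min δ 1 / (1 + m) with ha
  have ha0 : 0 < a := by positivity
  have ha1 : a ≤ 1 := by
    rw [ha, div_le_one (by positivity)]
    linarith [min_le_right δ 1]
  have h1 := H (a • U) ((integral_map_smul_le h (by rwa [abs_of_pos ha0]) U).trans_lt (by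
    rw [abs_of_pos ha0, ha, div_mul_eq_mul_div, div_lt_iff₀ (by positivity)]
    nlinarith [min_le_left δ 1]))
  rw [map_smul, smul_eq_mul, ← le_div_iff₀' ha0] at h1
  refine h1.trans_eq ?_
  rw [ha]
  field_simp

/-- If `0` is in the weak closure of a convex set of elements of finite modular, then the set has
elements of arbitrarily small modular. -/
theorem exists_modular_two_le [IsFiniteMeasure P] (h : IsOrliczFunction Φ)
    (hsup : Tendsto (fun t => Φ t / t) atTop atTop) {D : Set (orliczSpace h P)}
    (hD : Convex ℝ D) (hfin : ∀ W ∈ D, modular Φ 1 W.1 < ⊤)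
    (hweak : ∀ (Y : orliczSpace (h.conjugate hsup) P) (η : ℝ), 0 < η →
      ∃ W ∈ D, |pairing h hsup P W Y| < η) {δ : ℝ} (hδ : 0 < δ) :
    ∃ W ∈ D, modular Φ 2 W.1 ≤ ENNReal.ofReal δ + ENNReal.ofReal δ := by
  by_contra! hcon
  set T : Set (SimpleFunc Ω ℝ) := {U | ∃ W ∈ D,
    modular Φ 1 (W.1 - simpleToAEEqFun P U) ≤ ENNReal.ofReal δ} with hT
  have hTconv : Convex ℝ T := by
    refine convex_iff_forall_pos.2 ?_
    rintro U ⟨W, hW, hWU⟩ U' ⟨W', hW', hWU'⟩ a b ha hb hab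
    refine ⟨a • W + b • W', hD hW hW' ha.le hb.le hab, ?_⟩
    have := modular_convexCombo_le h one_pos hWU hWU' ha hb hab
    rw [simpleToAEEqFun_smul_add_smul]
    convert this using 2
    rw [Submodule.coe_add, Submodule.coe_smul, Submodule.coe_smul, smul_sub, smul_sub]
    abel
  have happrox : ∀ W ∈ D, ∀ Y : orliczSpace (h.conjugate hsup) P, ∀ η > 0,
      ∃ U ∈ T, |∫ ω, Y.1 ω * U ω ∂P - pairing h hsup P W Y| < η := by
    intro W hW Y η hη
    obtain ⟨U, hU1, hU2⟩ := exists_simpleFunc_approx h W.1 (hfin W hW)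
      Y.1.aestronglyMeasurable (integrable_mul h hsup W Y)
    obtain ⟨n, hn1, hn2⟩ := ((hU1.eventually (ge_mem_nhds (ENNReal.ofReal_pos.2 hδ))).and
      (Metric.tendsto_nhds.1 hU2 η hη)).exists
    exact ⟨U n, ⟨W, hW, hn1⟩, hn2⟩
  have hTne : T.Nonempty := by
    obtain ⟨W, hW, -⟩ := hweak 0 1 one_pos
    obtain ⟨U, hU, -⟩ := happrox W hW 0 1 one_pos
    exact ⟨U, hU⟩
  have hdisj : Disjoint {U : SimpleFunc Ω ℝ | ∫ ω, Φ |U ω| ∂P < δ} T := by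
    refine disjoint_left.2 ?_
    rintro U hU ⟨W, hW, hWU⟩
    -- With `U` common to both sets, `W = U + (W - U)` has modular at most `δ + δ` at scale `2`.
    have h1 := modular_add_le h one_pos one_pos (simpleToAEEqFun P U)
      (W.1 - simpleToAEEqFun P U)
    rw [add_sub_cancel, one_add_one_eq_two, modular_simpleToAEEqFun h] at h1
    exact absurd (h1.trans (add_le_add (ENNReal.ofReal_le_ofReal (le_of_lt hU)) hWU))
      (not_le.2 (hcon W hW))
  obtain ⟨f, ⟨γ, hγ, hfγ⟩, hf1⟩ := exists_linearMap_separating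
    (convex_simpleFunc_modular_lt h δ) (absorbent_simpleFunc_modular_lt h hδ) hTconv hTne hdisj
  obtain ⟨K, hK, hfK⟩ := exists_le_mul_one_add_modular h f hδ hf1
  obtain ⟨Y, hYm, hYi, hfY⟩ := exists_density h f hK hfK
  have hYK := lintegral_conjugate_le_one h hYm hYi hK fun U => hfY U ▸ hfK U
  have hae : AEEqFun.mk Y hYi.aestronglyMeasurable =ᵐ[P] Y := AEEqFun.coeFn_mk _ _
  have hYmem : AEEqFun.mk Y hYi.aestronglyMeasurable ∈ orliczSpace (h.conjugate hsup) P := by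
    refine (luxemburgNorm_lt_top_iff _).2 ⟨K, hK, le_of_eq_of_le ?_ hYK⟩
    refine lintegral_congr_ae ?_
    filter_upwards [hae] with ω hω
    rw [hω]
  obtain ⟨W, hW, hWY⟩ := hweak ⟨_, hYmem⟩ (γ / 2) (half_pos hγ)
  obtain ⟨U, hU, hUW⟩ := happrox W hW ⟨_, hYmem⟩ (γ / 2) (half_pos hγ)
  have hfU : f U = ∫ ω, (AEEqFun.mk Y hYi.aestronglyMeasurable : Ω →ₘ[P] ℝ) ω * U ω ∂P := by
    rw [hfY]
    refine integral_congr_ae ?_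
    filter_upwards [hae] with ω hω
    rw [hω]
  have h1 := hfγ U hU
  rw [hfU] at h1
  have h2 := (abs_lt.1 hUW).2
  have h3 := (abs_lt.1 hWY).2
  simp only at h2
  linarith

end Simple

/-! ### Order convergence, the Fatou property and weak closedness -/

section OrderConvergence

variable {Φ : ℝ → ℝ} {Ω : Type*} [MeasurableSpace Ω] {P : Measure Ω}

theorem ae_coe_sub (X Y : Ω →ₘ[P] ℝ) : ∀ᵐ ω ∂P, (X - Y) ω = X ω - Y ω :=
  AEEqFun.coeFn_sub X Y

/-- Summability of the modulars of the differences implies order convergence. -/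
theorem orderConverges_of_tsum_modular_lt_top (h : IsOrliczFunction Φ)
    (hpos : ∀ t : ℝ, 0 < t → 0 < Φ t) {c : ℝ} (hc : 0 < c) {X : ℕ → orliczSpace h P}
    {X₀ : orliczSpace h P} (hsum : ∑' n, modular Φ c ((X n).1 - X₀.1) < ⊤) :
    OrderConverges X X₀ := by
  set g : ℕ → Ω → ℝ≥0∞ := fun n ω => ENNReal.ofReal (Φ (|((X n).1 - X₀.1) ω| / c)) with hg
  have hgm : ∀ n, AEMeasurable (g n) P := fun n => h.aemeasurable hc _
  have hgsum : ∫⁻ ω, ∑' n, g n ω ∂P < ⊤ := by rwa [lintegral_tsum hgm]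
  have hfin : ∀ᵐ ω ∂P, ∑' n, g n ω < ⊤ :=
    ae_lt_top' (AEMeasurable.tsum hgm) hgsum.ne
  have hsub : ∀ᵐ ω ∂P, ∀ n, ((X n).1 - X₀.1) ω = (X n).1 ω - X₀.1 ω :=
    ae_all_iff.2 fun n => ae_coe_sub _ _
  have hlim : ∀ᵐ ω ∂P, Tendsto (fun n => |(X n).1 ω - X₀.1 ω|) atTop (𝓝 0) := by
    filter_upwards [hfin, hsub] with ω h1 h2
    have h3 := (ENNReal.tendsto_toReal ENNReal.zero_ne_top).comp
      (ENNReal.tendsto_atTop_zero_of_tsum_ne_top h1.ne)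
    have h4 : ∀ n, (g n ω).toReal = Φ (|(X n).1 ω - X₀.1 ω| / c) := fun n => by
      rw [hg]
      simp only [h2 n]
      rw [ENNReal.toReal_ofReal (h.nonneg (by positivity))]
    simp only [Function.comp_def, h4, ENNReal.toReal_zero] at h3
    have h5 := (h.tendsto_zero_of_tendsto hpos (fun n => by positivity) h3).mul_const c
    simpa [div_mul_cancel₀ _ hc.ne'] using h5
  refine ⟨?_, ?_⟩
  · filter_upwards [hlim] with ω hω
    exact tendsto_iff_dist_tendsto_zero.2 hω
  · set R : Ω → ℝ := fun ω => ⨆ n, |(X n).1 ω - X₀.1 ω| with hR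
    have hRm : Measurable R := Measurable.iSup fun n =>
      ((X n).1.stronglyMeasurable.measurable.sub X₀.1.stronglyMeasurable.measurable).abs
    have hbdd : ∀ᵐ ω ∂P, BddAbove (range fun n => |(X n).1 ω - X₀.1 ω|) := by
      filter_upwards [hlim] with ω hω
      exact hω.bddAbove_range
    set R' : Ω →ₘ[P] ℝ := AEEqFun.mk R hRm.aestronglyMeasurable
    have hR' : R' =ᵐ[P] R := AEEqFun.coeFn_mk _ _
    have hR'mem : R' ∈ orliczSpace h P := by
      refine mem_orliczSpace_of_modular_lt_top h (c := 2 * c) (by positivity)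
        (lt_of_le_of_lt (lintegral_mono_ae ?_) hgsum)
      filter_upwards [hR', hsub, hbdd] with ω h1 h2 h3
      rw [h1]
      have hR0 : 0 ≤ R ω := Real.iSup_nonneg fun n => abs_nonneg _
      rcases hR0.eq_or_lt with h0 | h0
      · simp [← h0, h.map_zero]
      -- The supremum `R ω` may not be attained, but some deviation exceeds half of it. The scale `2
      -- * c` absorbs the half, and one term of the sum bounds the integrand.
      · obtain ⟨n, hn⟩ := exists_lt_of_lt_ciSup (half_lt_self h0 : R ω / 2 < R ω)
        refine le_trans (ENNReal.ofReal_le_ofReal ?_) (ENNReal.le_tsum n)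
        refine h.monotoneOn (mem_Ici.2 (by positivity)) (mem_Ici.2 (by positivity)) ?_
        rw [h2, abs_of_pos h0, ← div_div]
        gcongr
    have habs : |X₀.1| ∈ orliczSpace h P := by
      obtain ⟨d, hd, hdX⟩ := (luxemburgNorm_lt_top_iff _).1 X₀.2
      refine (luxemburgNorm_lt_top_iff _).2 ⟨d, hd, (modular_mono h hd ?_).trans hdX⟩
      filter_upwards [AEEqFun.coeFn_abs X₀.1] with ω hω
      rw [hω, abs_abs]
    refine ⟨⟨|X₀.1| + R', Submodule.add_mem _ habs hR'mem⟩, fun n => ?_⟩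
    filter_upwards [AEEqFun.coeFn_abs X₀.1, AEEqFun.coeFn_add |X₀.1| R', hR', hbdd]
      with ω h1 h2 h3 h4
    rw [h2, Pi.add_apply, h1, h3]
    have h5 : |(X n).1 ω - X₀.1 ω| ≤ R ω := le_ciSup h4 n
    have h6 := abs_sub_abs_le_abs_sub ((X n).1 ω) (X₀.1 ω)
    linarith

theorem subset_orderClosure {h : IsOrliczFunction Φ} (C : Set (orliczSpace h P)) :
    C ⊆ orderClosure C := by
  intro X hX
  refine ⟨fun _ => X, fun _ => hX, Eventually.of_forall fun _ => tendsto_const_nhds,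
    ⟨|X.1|, ?_⟩, fun _ => ?_⟩
  · obtain ⟨d, hd, hdX⟩ := (luxemburgNorm_lt_top_iff _).1 X.2
    refine (luxemburgNorm_lt_top_iff _).2 ⟨d, hd, (modular_mono h hd ?_).trans hdX⟩
    filter_upwards [AEEqFun.coeFn_abs X.1] with ω hω
    rw [hω, abs_abs]
  · filter_upwards [AEEqFun.coeFn_abs X.1] with ω hω
    exact hω.ge

/-- The Fatou property of the multiples of the unit ball. -/
theorem mem_smul_unitBall_of_tendsto (h : IsOrliczFunction Φ) {k : ℝ} (hk : 0 < k)
    {X : ℕ → orliczSpace h P} {X₀ : orliczSpace h P} (hX : ∀ n, X n ∈ k • unitBall h P)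
    (hlim : ∀ᵐ ω ∂P, Tendsto (fun n => (X n).1 ω) atTop (𝓝 (X₀.1 ω))) :
    X₀ ∈ k • unitBall h P := by
  simp only [mem_smul_unitBall_iff h hk] at hX ⊢
  intro c hc
  -- The slack `d < c` makes `|X n| / d` eventually exceed `|X₀| / c` wherever `X₀ ≠ 0`, so
  -- monotonicity of `Φ` suffices.
  obtain ⟨d, hkd, hdc⟩ := exists_between hc
  have hd := hk.trans hkd
  have hc0 := hd.trans hdc
  calc modular Φ c X₀.1
      ≤ ∫⁻ ω, liminf (fun n => ENNReal.ofReal (Φ (|(X n).1 ω| / d))) atTop ∂P := by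
        refine lintegral_mono_ae ?_
        filter_upwards [hlim] with ω hω
        rcases (abs_nonneg (X₀.1 ω)).eq_or_lt with h0 | h0
        · simp [← h0, h.map_zero]
        refine le_liminf_of_le (by isBoundedDefault) ?_
        have h1 : |X₀.1 ω| / c < |X₀.1 ω| / d := by gcongr
        filter_upwards [(hω.abs.div_const d).eventually (lt_mem_nhds h1)] with n hn
        exact ENNReal.ofReal_le_ofReal (h.monotoneOn (mem_Ici.2 (by positivity))
          (mem_Ici.2 (by positivity)) hn.le)
    _ ≤ liminf (fun n => ∫⁻ ω, ENNReal.ofReal (Φ (|(X n).1 ω| / d)) ∂P) atTop :=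
        lintegral_liminf_le' fun n => h.aemeasurable hd _
    _ ≤ 1 := (liminf_le_liminf (Eventually.of_forall fun n => hX n d hkd)).trans (by simp)

theorem continuous_pairing (h : IsOrliczFunction Φ)
    (hsup : Tendsto (fun t => Φ t / t) atTop atTop) (Y : orliczSpace (h.conjugate hsup) P) :
    @Continuous _ _ (weakTopology h hsup P) _ fun X => pairing h hsup P X Y :=
  WeakBilin.eval_continuous (pairing h hsup P) Y

theorem tendsto_weakTopology_of_forall_pairing (h : IsOrliczFunction Φ)
    (hsup : Tendsto (fun t => Φ t / t) atTop atTop) {X : ℕ → orliczSpace h P}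
    {X₀ : orliczSpace h P}
    (hX : ∀ Y, Tendsto (fun n => pairing h hsup P (X n) Y) atTop (𝓝 (pairing h hsup P X₀ Y))) :
    Tendsto X atTop (@nhds _ (weakTopology h hsup P) X₀) := by
  have : @nhds _ (weakTopology h hsup P) X₀
      = comap (fun X Y => pairing h hsup P X Y) (𝓝 fun Y => pairing h hsup P X₀ Y) :=
    nhds_induced _ _
  rw [this, tendsto_comap_iff]
  exact tendsto_pi_nhds.2 hX

/-- Order convergence implies weak convergence. -/
theorem OrderConverges.tendsto_weakTopology {h : IsOrliczFunction Φ}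
    (hsup : Tendsto (fun t => Φ t / t) atTop atTop) {X : ℕ → orliczSpace h P}
    {X₀ : orliczSpace h P} (hX : OrderConverges X X₀) :
    Tendsto X atTop (@nhds _ (weakTopology h hsup P) X₀) := by
  refine tendsto_weakTopology_of_forall_pairing h hsup fun Y => ?_
  obtain ⟨hlim, Z, hZ⟩ := hX
  refine tendsto_integral_of_dominated_convergence (fun ω => ‖Z.1 ω * Y.1 ω‖)
    (fun n => (integrable_mul h hsup (X n) Y).aestronglyMeasurable)
    (integrable_mul h hsup Z Y).norm (fun n => ?_) ?_
  · filter_upwards [hZ n] with ω hω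
    rw [norm_mul, norm_mul]
    exact mul_le_mul_of_nonneg_right (hω.trans (le_abs_self _)) (norm_nonneg _)
  · filter_upwards [hlim] with ω hω
    exact hω.mul_const _

/-- A convex set contained in a ball and closed under order limits is weakly closed. -/
theorem isClosed_inter_of_isOrderClosed [IsFiniteMeasure P] (h : IsOrliczFunction Φ)
    (hpos : ∀ t : ℝ, 0 < t → 0 < Φ t) (hsup : Tendsto (fun t => Φ t / t) atTop atTop)
    {C : Set (orliczSpace h P)} (hC : Convex ℝ C) (hCo : IsOrderClosed C) {k : ℝ} (hk : 0 < k) :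
    IsClosed[weakTopology h hsup P] (C ∩ k • unitBall h P) := by
  let _ := weakTopology h hsup P
  refine isClosed_of_closure_subset fun X₀ hX₀ => ?_
  obtain ⟨c₀, hc₀, hcX₀⟩ := (luxemburgNorm_lt_top_iff _).1 X₀.2
  -- If `X₀ + c W ∈ kB`, then `c W` is a sum of elements with modular at most `1` at scales `k + 1`
  -- and `c₀`, so `W` has finite modular at scale `1`.
  set c := k + 1 + c₀
  have hc : 0 < c := by positivity
  set D : Set (orliczSpace h P) := {W | X₀ + c • W ∈ C ∩ k • unitBall h P} with hD
  have hDconv : Convex ℝ D := by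
    intro V hV W hW a b ha hb hab
    have := (hC.inter (convex_smul_unitBall h hk)) hV hW ha hb hab
    have h1 : a • (X₀ + c • V) + b • (X₀ + c • W) = X₀ + c • (a • V + b • W) := by
      calc a • (X₀ + c • V) + b • (X₀ + c • W) = (a + b) • X₀ + c • (a • V + b • W) := by module
        _ = _ := by rw [hab, one_smul]
    rwa [h1] at this
  have hDfin : ∀ W ∈ D, modular Φ 1 W.1 < ⊤ := by
    intro W hW
    have h1 := modular_add_le h (by positivity : 0 < k + 1) hc₀ (X₀.1 + c • W.1) (-X₀.1)
    rw [modular_neg, add_neg_cancel_comm, modular_smul _ hc, div_self hc.ne'] at h1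
    have h2 : modular Φ (k + 1) (X₀.1 + c • W.1) ≤ 1 :=
      (mem_smul_unitBall_iff h hk _).1 hW.2 _ (by linarith)
    exact h1.trans_lt (ENNReal.add_lt_top.2
      ⟨h2.trans_lt ENNReal.one_lt_top, hcX₀.trans_lt ENNReal.one_lt_top⟩)
  have hDweak : ∀ (Y : orliczSpace (h.conjugate hsup) P) (η : ℝ), 0 < η →
      ∃ W ∈ D, |pairing h hsup P W Y| < η := by
    intro Y η hη
    have hcont : Continuous fun X => pairing h hsup P X Y := continuous_pairing h hsup Y
    obtain ⟨X, hX1, hX2⟩ := mem_closure_iff.1 hX₀ _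
      (Metric.isOpen_ball.preimage hcont : IsOpen ((fun X => pairing h hsup P X Y) ⁻¹'
        Metric.ball (pairing h hsup P X₀ Y) (c * η))) (Metric.mem_ball_self (by positivity))
    refine ⟨c⁻¹ • (X - X₀), ?_, ?_⟩
    · rw [hD, mem_ofPred_eq, smul_inv_smul₀ hc.ne', add_sub_cancel]
      exact hX2
    · rw [map_smul, map_sub, LinearMap.smul_apply, LinearMap.sub_apply, smul_eq_mul, abs_mul,
        abs_of_pos (inv_pos.2 hc), inv_mul_lt_iff₀ hc]
      exact hX1
  choose W hWD hWmod using fun n : ℕ =>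
    exists_modular_two_le h hsup hDconv hDfin hDweak (δ := (1 / 2) ^ n) (by positivity)
  have hconv : OrderConverges (fun n => X₀ + c • W n) X₀ := by
    refine orderConverges_of_tsum_modular_lt_top h hpos (c := 2 * c) (by positivity) ?_
    have h1 : ∀ n, modular Φ (2 * c) ((X₀ + c • W n : orliczSpace h P).1 - X₀.1)
        = modular Φ 2 (W n).1 := fun n => by
      rw [Submodule.coe_add, add_sub_cancel_left, Submodule.coe_smul, modular_smul _ hc,
        mul_div_cancel_right₀ _ hc.ne']
    simp only [h1]
    have h2 : ∑' n : ℕ, ENNReal.ofReal ((1 / 2 : ℝ) ^ n) < ⊤ :=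
      (ENNReal.ofReal_tsum_of_nonneg (fun n => by positivity) summable_geometric_two) ▸
        ENNReal.ofReal_lt_top
    refine (ENNReal.tsum_le_tsum hWmod).trans_lt ?_
    rw [ENNReal.tsum_add]
    exact ENNReal.add_lt_top.2 ⟨h2, h2⟩
  refine ⟨?_, mem_smul_unitBall_of_tendsto h hk (fun n => (hWD n).2) hconv.1⟩
  rw [hCo]
  exact ⟨_, fun n => (hWD n).1, hconv⟩

end OrderConvergence

/-! ### Weakly bounded sequences are norm bounded -/

section UniformBoundedness

variable {Φ : ℝ → ℝ} {Ω : Type*} [MeasurableSpace Ω] {P : Measure Ω}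

/-- The uniform boundedness principle for functionals on `ℓ¹`, in terms of coefficients. -/
theorem exists_bound_of_forall_summable (b : ℕ → ℕ → ℝ) (hb : ∀ n, ∃ M, ∀ j, |b n j| ≤ M)
    (H : ∀ a : ℕ → ℝ, Summable (fun j => |a j|) → ∃ M, ∀ n, |∑' j, a j * b n j| ≤ M) :
    ∃ M, ∀ n j, |b n j| ≤ M := by
  choose M hM using hb
  have hnorm : ∀ a : lp (fun _ : ℕ => ℝ) 1, HasSum (fun j => |a j|) ‖a‖ := fun a => by
    simpa using lp.hasSum_norm (p := 1) (by simp) a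
  have hle : ∀ n (a : lp (fun _ : ℕ => ℝ) 1) j, |a j * b n j| ≤ |a j| * M n := fun n a j => by
    rw [abs_mul]
    exact mul_le_mul_of_nonneg_left (hM n j) (abs_nonneg _)
  have hsummable : ∀ n (a : lp (fun _ : ℕ => ℝ) 1), Summable fun j => a j * b n j := fun n a =>
    Summable.of_norm_bounded ((hnorm a).summable.mul_right (M n)) (hle n a)
  let T : ℕ → lp (fun _ : ℕ => ℝ) 1 →L[ℝ] ℝ := fun n => LinearMap.mkContinuous
    { toFun := fun a => ∑' j, a j * b n j
      map_add' := fun x y => by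
        rw [← (hsummable n x).tsum_add (hsummable n y)]
        exact tsum_congr fun j => by rw [lp.coeFn_add, Pi.add_apply, add_mul]
      map_smul' := fun r x => by
        rw [RingHom.id_apply, smul_eq_mul, ← tsum_mul_left]
        exact tsum_congr fun j => by
          rw [lp.coeFn_smul, Pi.smul_apply, smul_eq_mul, mul_assoc] }
    (M n) fun a => by
      rw [mul_comm]
      exact tsum_of_norm_bounded ((hnorm a).mul_right (M n)) (hle n a)
  have hT : ∀ n a, T n a = ∑' j, a j * b n j := fun n a => rfl
  obtain ⟨K, hK⟩ := banach_steinhaus (g := T) fun a => by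
    obtain ⟨M', hM'⟩ := H a (hnorm a).summable
    exact ⟨M', fun n => by rw [hT]; exact hM' n⟩
  refine ⟨K, fun n j => ?_⟩
  -- Unit vectors of `ℓ¹` recover the coefficients from the uniform norm bound.
  have h1 : T n (lp.single 1 j 1) = b n j := by
    rw [hT, tsum_eq_single j]
    · simp
    · intro i hi
      simp [lp.single_apply, hi]
  have h2 := (T n).le_of_opNorm_le (hK n) (lp.single 1 j 1)
  rw [h1, lp.norm_single one_pos, norm_one, mul_one] at h2
  exact h2

theorem integral_abs_mul_le (h : IsOrliczFunction Φ)
    (hsup : Tendsto (fun t => Φ t / t) atTop atTop) {c d : ℝ} (hc : 0 < c) (hd : 0 < d)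
    {X Y : Ω →ₘ[P] ℝ} (hX : modular Φ c X ≤ 1) (hY : modular (conjugate Φ) d Y ≤ 1) :
    ∫ ω, ‖X ω * Y ω‖ ∂P ≤ c * d * 2 := by
  have hmeas : AEStronglyMeasurable (fun ω => ‖X ω * Y ω‖) P :=
    (X.aestronglyMeasurable.mul Y.aestronglyMeasurable).norm
  rw [integral_eq_lintegral_of_nonneg_ae (Eventually.of_forall fun ω => norm_nonneg _) hmeas]
  refine ENNReal.toReal_le_of_le_ofReal (by positivity) ?_
  have hle : ∀ ω, ENNReal.ofReal ‖X ω * Y ω‖ ≤ ENNReal.ofReal (c * d) *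
      (ENNReal.ofReal (Φ (|X ω| / c)) + ENNReal.ofReal (conjugate Φ (|Y ω| / d))) := by
    intro ω
    have hx : (0 : ℝ) ≤ |X ω| / c := by positivity
    have hy : (0 : ℝ) ≤ |Y ω| / d := by positivity
    rw [← ENNReal.ofReal_add (h.nonneg hx) ((h.conjugate hsup).nonneg hy),
      ← ENNReal.ofReal_mul (by positivity)]
    refine ENNReal.ofReal_le_ofReal ?_
    have h1 := mul_le_mul_of_nonneg_left (young h hsup hx hy) (by positivity : 0 ≤ c * d)
    have h2 : c * d * (|X ω| / c * (|Y ω| / d)) = |X ω| * |Y ω| := by field_simp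
    rw [Real.norm_eq_abs, abs_mul]
    linarith
  refine (lintegral_mono hle).trans ?_
  rw [lintegral_const_mul' _ _ ENNReal.ofReal_ne_top, lintegral_add_left' (h.aemeasurable hc X),
    ENNReal.ofReal_mul (by positivity : 0 ≤ c * d)]
  gcongr
  calc _ ≤ (1 : ℝ≥0∞) + 1 := add_le_add hX hY
    _ = ENNReal.ofReal 2 := by norm_num

/-- Jensen's inequality for the conjugate function and countable subconvex combinations. -/
theorem ofReal_conjugate_tsum_le (h : IsOrliczFunction Φ)
    (hsup : Tendsto (fun t => Φ t / t) atTop atTop) {p : ℕ → ℝ} (hp : ∀ j, 0 ≤ p j)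
    (hps : Summable p) (hp1 : ∑' j, p j ≤ 1) {v : ℕ → ℝ} (hv : ∀ j, 0 ≤ v j)
    (hpv : Summable fun j => p j * v j) :
    ENNReal.ofReal (conjugate Φ (∑' j, p j * v j)) ≤
      ∑' j, ENNReal.ofReal (p j) * ENNReal.ofReal (conjugate Φ (v j)) := by
  have hΨ : ∀ j, 0 ≤ conjugate Φ (v j) := fun j => (h.conjugate hsup).nonneg (hv j)
  simp only [← ENNReal.ofReal_mul (hp _)]
  by_cases htop : ∑' j, ENNReal.ofReal (p j * conjugate Φ (v j)) = ⊤
  · rw [htop]; exact le_top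
  have hs : Summable fun j => p j * conjugate Φ (v j) := by
    have := ENNReal.summable_toReal htop
    simpa only [ENNReal.toReal_ofReal (mul_nonneg (hp _) (hΨ _))] using this
  rw [← ENNReal.ofReal_tsum_of_nonneg (fun j => mul_nonneg (hp j) (hΨ j)) hs]
  refine ENNReal.ofReal_le_ofReal (csSup_le (nonempty_Ici.image _) ?_)
  rintro _ ⟨t, ht, rfl⟩
  -- Young's inequality is weighted by `p j` and summed for each fixed `t`; total weight at most `1`
  -- then suffices because `Φ t ≥ 0`.
  have h1 : ∑' j, t * (p j * v j) ≤ ∑' j, (p j * Φ t + p j * conjugate Φ (v j)) := by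
    refine (hpv.mul_left t).tsum_le_tsum (fun j => ?_) ((hps.mul_right _).add hs)
    have := mul_le_mul_of_nonneg_left (young h hsup (mem_Ici.1 ht) (hv j)) (hp j)
    linarith
  rw [tsum_mul_left, (hps.mul_right _).tsum_add hs, tsum_mul_right] at h1
  have h2 := mul_le_mul_of_nonneg_right hp1 (h.nonneg (mem_Ici.1 ht))
  simp only
  linarith

/-- Absolutely convergent combinations of elements of the modular unit ball. -/
theorem exists_tsum_mem_orliczSpace (h : IsOrliczFunction Φ)
    (hsup : Tendsto (fun t => Φ t / t) atTop atTop) {V : ℕ → orliczSpace (h.conjugate hsup) P}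
    (hV : ∀ j, modular (conjugate Φ) 1 (V j).1 ≤ 1) {a : ℕ → ℝ} (ha : Summable fun j => |a j|) :
    ∃ Y : orliczSpace (h.conjugate hsup) P, ∀ᵐ ω ∂P, Y.1 ω = ∑' j, a j * (V j).1 ω := by
  have hm : Measurable fun ω => ∑' j, a j * (V j).1 ω := Measurable.tsum fun j =>
    (V j).1.stronglyMeasurable.measurable.const_mul (a j)
  have hae : AEEqFun.mk _ hm.aestronglyMeasurable =ᵐ[P] fun ω => ∑' j, a j * (V j).1 ω :=
    AEEqFun.coeFn_mk _ _
  set A := ∑' j, |a j| + 1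
  have hA0 : 0 ≤ ∑' j, |a j| := tsum_nonneg fun j => abs_nonneg _
  have hA : 0 < A := by positivity
  have hp : ∀ j, 0 ≤ |a j| / A := fun j => by positivity
  have hps : Summable fun j => |a j| / A := ha.div_const A
  have hp1 : ∑' j, |a j| / A ≤ 1 := by
    rw [tsum_div_const, div_le_one hA]
    exact (lt_add_one _).le
  have hΨ := h.conjugate hsup
  refine ⟨⟨AEEqFun.mk _ hm.aestronglyMeasurable,
    (luxemburgNorm_lt_top_iff _).2 ⟨A, hA, ?_⟩⟩, hae⟩
  calc modular (conjugate Φ) A (AEEqFun.mk _ hm.aestronglyMeasurable)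
      ≤ ∫⁻ ω, ∑' j, ENNReal.ofReal (|a j| / A) *
          ENNReal.ofReal (conjugate Φ (|(V j).1 ω| / 1)) ∂P := by
        refine lintegral_mono_ae ?_
        filter_upwards [hae] with ω hω
        rw [hω]
        simp only [div_one]
        by_cases hsm : Summable fun j => a j * (V j).1 ω
        · have h1 : Summable fun j => |a j| / A * |(V j).1 ω| :=
            (hsm.abs.div_const A).congr fun j => by rw [abs_mul]; ring
          refine le_trans (ENNReal.ofReal_le_ofReal (hΨ.monotoneOn (mem_Ici.2 (by positivity))
            (mem_Ici.2 (tsum_nonneg fun j => by positivity)) ?_))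
            (ofReal_conjugate_tsum_le h hsup hp hps hp1 (fun j => abs_nonneg ((V j).1 ω)) h1)
          have h2 : ∑' j, |a j| / A * |(V j).1 ω| = (∑' j, |a j * (V j).1 ω|) / A := by
            rw [← tsum_div_const]
            exact tsum_congr fun j => by rw [abs_mul]; ring
          rw [h2]
          gcongr
          exact norm_tsum_le_tsum_norm hsm.norm
        -- Where the series diverges its sum is `0` by default, and the bound is trivial.
        · simp [tsum_eq_zero_of_not_summable hsm, hΨ.map_zero]
    _ = ∑' j, ENNReal.ofReal (|a j| / A) * modular (conjugate Φ) 1 (V j).1 := by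
        rw [lintegral_tsum fun j => (hΨ.aemeasurable one_pos _).const_mul _]
        exact tsum_congr fun j => lintegral_const_mul' _ _ ENNReal.ofReal_ne_top
    _ ≤ ∑' j, ENNReal.ofReal (|a j| / A) :=
        ENNReal.tsum_le_tsum fun j => mul_le_of_le_one_right' (hV j)
    _ ≤ 1 := by
        rw [← ENNReal.ofReal_tsum_of_nonneg hp hps]
        exact ENNReal.ofReal_le_one.2 hp1

/-- A weakly bounded sequence in `L^Φ` is bounded. -/
theorem exists_modular_le_one_of_weakly_bounded [IsFiniteMeasure P] (h : IsOrliczFunction Φ)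
    (hsup : Tendsto (fun t => Φ t / t) atTop atTop) {X : ℕ → orliczSpace h P}
    (hX : ∀ Y, ∃ M, ∀ n, |pairing h hsup P (X n) Y| ≤ M) :
    ∃ K > 0, ∀ n, modular Φ K (X n).1 ≤ 1 := by
  have hΨ := h.conjugate hsup
  have hpair : ∀ n (U : SimpleFunc Ω ℝ),
      ∫ ω, (X n).1 ω * U ω ∂P = pairing h hsup P (X n) ⟨_, simpleToAEEqFun_mem hΨ U⟩ := by
    intro n U
    refine integral_congr_ae ?_
    filter_upwards [coeFn_simpleToAEEqFun (P := P) U] with ω hω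
    rw [hω]
  have hXint : ∀ n, Integrable (fun ω => (X n).1 ω) P := by
    intro n
    refine (integrable_mul h hsup (X n) ⟨_, simpleToAEEqFun_mem hΨ (SimpleFunc.const Ω 1)⟩).congr ?_
    filter_upwards [coeFn_simpleToAEEqFun (P := P) (SimpleFunc.const Ω (1 : ℝ))] with ω hω
    rw [hω, SimpleFunc.const_apply, mul_one]
  suffices hK : ∃ K > 0, ∀ n (U : SimpleFunc Ω ℝ),
      ∫ ω, (X n).1 ω * U ω ∂P ≤ K * (1 + ∫ ω, conjugate Φ |U ω| ∂P) by
    obtain ⟨K, hK, hKU⟩ := hK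
    -- The duality bound is applied to the conjugate function, and biconjugation returns to `Φ`.
    refine ⟨K, hK, fun n => le_trans (lintegral_mono fun ω => ENNReal.ofReal_le_ofReal
      (le_conjugate_conjugate h hsup (by positivity))) (lintegral_conjugate_le_one hΨ
        (X n).1.stronglyMeasurable.measurable (hXint n) hK (hKU n))⟩
  by_contra! hcon
  -- Failure of every constant `j + 1` gives `U j`. Dividing by one plus its modular yields `V j` in
  -- the modular unit ball, with pairing against `X (N j)` still above `j + 1`.
  choose N U hU using fun j : ℕ => hcon (j + 1) (by positivity)
  have hm0 : ∀ j, 0 < 1 + ∫ ω, conjugate Φ |U j ω| ∂P := fun j => by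
    have : 0 ≤ ∫ ω, conjugate Φ |U j ω| ∂P := integral_nonneg fun ω => hΨ.nonneg (abs_nonneg _)
    linarith
  set V : ℕ → SimpleFunc Ω ℝ := fun j => (1 + ∫ ω, conjugate Φ |U j ω| ∂P)⁻¹ • U j with hVdef
  have hV : ∀ j, modular (conjugate Φ) 1 (simpleToAEEqFun P (V j)) ≤ 1 := by
    intro j
    rw [modular_simpleToAEEqFun hΨ, ENNReal.ofReal_le_one]
    have h0 : 0 ≤ ∫ ω, conjugate Φ |U j ω| ∂P := integral_nonneg fun ω => hΨ.nonneg (abs_nonneg _)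
    refine (integral_map_smul_le hΨ ?_ (U j)).trans ?_
    · rw [abs_inv, abs_of_pos (hm0 j)]
      exact inv_le_one_of_one_le₀ (by linarith)
    · rw [abs_inv, abs_of_pos (hm0 j), inv_mul_le_iff₀ (hm0 j)]
      linarith
  have hVX : ∀ j : ℕ, (j : ℝ) + 1 < ∫ ω, (X (N j)).1 ω * V j ω ∂P := by
    intro j
    have : ∀ ω, (X (N j)).1 ω * V j ω
        = (1 + ∫ ω, conjugate Φ |U j ω| ∂P)⁻¹ * ((X (N j)).1 ω * U j ω) := fun ω => by
      simp only [hVdef, SimpleFunc.coe_smul, Pi.smul_apply, smul_eq_mul]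
      ring
    simp only [this]
    rw [integral_const_mul, lt_inv_mul_iff₀ (hm0 j), mul_comm]
    exact hU j
  set V' : ℕ → orliczSpace hΨ P := fun j => ⟨_, simpleToAEEqFun_mem hΨ (V j)⟩
  obtain ⟨M, hM⟩ := exists_bound_of_forall_summable
    (fun n j => pairing h hsup P (X n) (V' j)) (fun n => by
      obtain ⟨c, hc, hcX⟩ := (luxemburgNorm_lt_top_iff _).1 (X n).2
      exact ⟨c * 1 * 2, fun j => (norm_integral_le_integral_norm _).trans
        (integral_abs_mul_le h hsup hc one_pos hcX (hV j))⟩) (fun a ha => by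
      obtain ⟨Y, hY⟩ := exists_tsum_mem_orliczSpace h hsup (V := V') hV ha
      obtain ⟨M, hM⟩ := hX Y
      refine ⟨M, fun n => ?_⟩
      obtain ⟨c, hc, hcX⟩ := (luxemburgNorm_lt_top_iff _).1 (X n).2
      have hint := fun j => (integrable_mul h hsup (X n) (V' j)).const_mul (a j)
      -- The uniform Hölder bound and `a ∈ ℓ¹` allow exchanging sum and integral, so the series of
      -- pairings is the pairing with `Y`.
      have hsum := hasSum_integral_of_summable_integral_norm hint (by
        refine Summable.of_nonneg_of_le (fun j => integral_nonneg fun ω => norm_nonneg _)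
          (fun j => ?_) (ha.mul_right (c * 1 * 2))
        simp only [norm_mul (a j)]
        rw [integral_const_mul, Real.norm_eq_abs]
        gcongr
        exact integral_abs_mul_le h hsup hc one_pos hcX (hV j))
      have h1 : ∑' j, a j * pairing h hsup P (X n) (V' j) = pairing h hsup P (X n) Y := by
        simp only [integral_const_mul] at hsum
        refine hsum.tsum_eq.trans (integral_congr_ae ?_)
        filter_upwards [hY] with ω hω
        rw [hω, ← tsum_mul_left]
        exact tsum_congr fun j => by ring
      rw [h1]
      exact hM n)
  obtain ⟨j, hj⟩ := exists_nat_gt M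
  have h1 := hVX j
  rw [hpair] at h1
  have h2 := (le_abs_self _).trans (hM (N j) j)
  linarith

end UniformBoundedness

end Orlicz

/-! ### The equivalence -/

theorem mainTheorem6 {Ω : Type*} [MeasurableSpace Ω] (P : Measure Ω) [IsProbabilityMeasure P]
    (hP : Orlicz.IsNonatomic P) (Φ : ℝ → ℝ) (hΦ : Orlicz.IsOrliczFunction Φ)
    (hpos : ∀ t : ℝ, 0 < t → 0 < Φ t) (hsup : Tendsto (fun t => Φ t / t) atTop atTop)
    (C : Set (Orlicz.orliczSpace hΦ P)) (hC : Convex ℝ C) :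
    List.TFAE [
      Orlicz.IsOrderClosed C,
      @IsSeqClosed _ (Orlicz.weakTopology hΦ hsup P) C,
      ∀ k : ℕ, 1 ≤ k →
        IsClosed[Orlicz.weakTopology hΦ hsup P] (C ∩ (k : ℝ) • Orlicz.unitBall hΦ P)] := by
  let _ := Orlicz.weakTopology hΦ hsup P
  tfae_have 1 → 3 := fun h1 k hk =>
    Orlicz.isClosed_inter_of_isOrderClosed hΦ hpos hsup hC h1 (by positivity)
  tfae_have 3 → 2 := by
    intro h3 X X₀ hX hlim
    obtain ⟨K, hK, hKX⟩ := Orlicz.exists_modular_le_one_of_weakly_bounded hΦ hsup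
      (X := X) fun Y => by
        obtain ⟨M, hM⟩ := (((Orlicz.continuous_pairing hΦ hsup Y).tendsto X₀).comp
          hlim).abs.bddAbove_range
        exact ⟨M, fun n => hM ⟨n, rfl⟩⟩
    obtain ⟨k, hk⟩ := exists_nat_gt K
    have hk0 : (0 : ℝ) < k := hK.trans hk
    refine ((h3 k (Nat.cast_pos.1 hk0)).isSeqClosed (fun n => ⟨hX n, ?_⟩) hlim).1
    exact (Orlicz.mem_smul_unitBall_iff hΦ hk0 _).2 fun c hc =>
      (Orlicz.modular_anti hΦ hK (hk.trans hc).le _).trans (hKX n)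
  tfae_have 2 → 1 := by
    intro h2
    refine Subset.antisymm (Orlicz.subset_orderClosure C) ?_
    rintro X₀ ⟨X, hXC, hX⟩
    exact h2 hXC (hX.tendsto_weakTopology hsup)
  tfae_finish
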